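/- Let $N\ge 0$ be fixed, let $A,C\in\mathbb R^{N\times N}$ and $\sigma_v>0$ be fixed, and for every $M\in\mathbb N$ let $G_M\in\mathbb R^{M\times N}$. Consider, for each $M$, the stationary Gaussian dynamic factor model $$x_{t+1}=Ax_t+Cw_{t+1},\qquad y_t=G_Mx_t+v_t,\qquad t\in\mathbb Z,$$ where $(w_t)$ is i.i.d. $\mathcal N(0,I_N)$, $(v_t)$ is i.i.d. $\mathcal N(0,R_M)$ with $R_M=\sigma_v^2I_M$, the sequences $(w_t)$ and $(v_t)$ are independent, and $x_t$ is square integrable with a law that does not depend on $t$. Assume that all eigenvalues of $A$ have modulus less than $1$, that $A$ and $C$ are invertible, that $\operatorname{rank}(G_M)=N$ for all large $M$, and that $G_M^\top G_M$ is of order $M$, i.e. $\|G_M^\top G_M\|=O(M)$ and $\|(G_M^\top G_M)^{-1}\|=O(1/M)$ as $M\to\infty$, where $\|\cdot\|$ is the Frobenius norm. For each $M$, the Riccati equation $$\Sigma=CC^\top+KR_MK^\top+(A-KG_M)\Sigma(A-KG_M)^\top,\qquad K=A\Sigma G_M^\top(G_M\Sigma G_M^\top+R_M)^{-1},$$ has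 exactly one positive semidefinite solution $\Sigma=\Sigma_M$. It is positive definite, and it is the covariance matrix of $x_t-\mathbb E[x_t\mid y_s,\,s<t]$ for every $t$. Let $K=K_M$ be the corresponding gain, put $B_j=B_{j,M}=G_M(A-K_MG_M)^{j-1}K_M$ for $j\ge1$, and let $a_t=y_t-\mathbb E[y_t\mid y_s,\,s<t]$. Then $y_t$ has the infinite-order VAR representation $$y_t=\sum_{j=1}^\infty B_jy_{t-j}+a_t\ \text{ almost surely},\qquad \mathbb E[a_ty_{t-j}^\top]=0\ (j\ge1),\qquad \mathbb E[a_ta_t^\top]=G_M\Sigma_MG_M^\top+R_M ,$$ and, as $M\to\infty$: 1. For every $j\ge2$, $\|B_{j,M}\|\to0$; moreover $\limsup_{M\to\infty}M^{j-1}\|B_{j,M}\|<\infty$. 2. The representation collapses to the first-order VAR $y_t=B_1y_{t-1}+a_t$: for every $t$, $$\mathbb E\,\bigl\|y_t-B_{1,M}y_{t-1}-a_t\bigr\|^2\to0,$$ where $\mathbb E[a_ty_{t-1}^\top]=0$, $\mathbb E[a_ta_t^\top]=G_M\Sigma_MG_M^\top+R_M$, $B_{1,M}=G_MK_M$, and $\operatorname{rank}(B_{1,M})=N$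 for every $M$ with $\operatorname{rank}(G_M)=N$. -/

import Mathlib

open MeasureTheory ProbabilityTheory Filter Topology Asymptotics
-- Throughout, the norm of a matrix is the Frobenius norm.
open scoped Matrix Matrix.Norms.Frobenius

namespace DFM

noncomputable section

/-- The matrix `E[u vᵀ]` of two random vectors. -/
def crossMoment {Ω : Type*} [MeasurableSpace Ω] (P : Measure Ω) {m n : ℕ}
    (u : Ω → EuclideanSpace ℝ (Fin m)) (v : Ω → EuclideanSpace ℝ (Fin n)) :
    Matrix (Fin m) (Fin n) ℝ :=
  Matrix.of fun i k => ∫ ω, u ω i * v ω k ∂P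

/-- The σ-algebra generated by the strict past `y_s`, `s < t`, of a process. -/
abbrev past {Ω : Type*} {m : ℕ} (y : ℤ → Ω → EuclideanSpace ℝ (Fin m)) (t : ℤ) :
    MeasurableSpace Ω :=
  ⨆ s : Set.Iio t, MeasurableSpace.comap (y s) inferInstance

/-- The one-step prediction error `z_t - E[z_t ∣ y_{t-1}, y_{t-2}, …]`. For `z = y` this is the
innovation `a_t` of `y`. -/
def predError {Ω : Type*} [MeasurableSpace Ω] (P : Measure Ω) {m n : ℕ}
    (z : ℤ → Ω → EuclideanSpace ℝ (Fin n)) (y : ℤ → Ω → EuclideanSpace ℝ (Fin m)) (t : ℤ) :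
    Ω → EuclideanSpace ℝ (Fin n) :=
  z t - P[z t | past y t]

/-- All eigenvalues of the real matrix `A`, real or complex, have modulus less than one. -/
def IsStable {N : ℕ} (A : Matrix (Fin N) (Fin N) ℝ) : Prop :=
  ∀ z ∈ spectrum ℂ (A.map (algebraMap ℝ ℂ)), ‖z‖ < 1

/-- The stationary Gaussian dynamic factor model
`x_{t+1} = A x_t + C w_{t+1}`, `y_t = G x_t + v_t`, `t ∈ ℤ`,
with independent Gaussian white noises `w_t ∼ 𝒩(0, I)` and `v_t ∼ 𝒩(0, R)`. -/
structure IsGaussianDFM {Ω : Type*} [MeasurableSpace Ω] (P : Measure Ω) {N M : ℕ}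
    (A C : Matrix (Fin N) (Fin N) ℝ) (G : Matrix (Fin M) (Fin N) ℝ) (R : Matrix (Fin M) (Fin M) ℝ)
    (x w : ℤ → Ω → EuclideanSpace ℝ (Fin N)) (y v : ℤ → Ω → EuclideanSpace ℝ (Fin M)) : Prop where
  measurable_x : ∀ t, Measurable (x t)
  measurable_w : ∀ t, Measurable (w t)
  measurable_y : ∀ t, Measurable (y t)
  measurable_v : ∀ t, Measurable (v t)
  law_w : ∀ t, HasLaw (w t) (multivariateGaussian 0 1) P
  law_v : ∀ t, HasLaw (v t) (multivariateGaussian 0 R) P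
  indep_w : iIndepFun w P
  indep_v : iIndepFun v P
  indep_w_v : IndepFun (fun ω t => w t ω) (fun ω t => v t ω) P
  state_eq : ∀ t, ∀ᵐ ω ∂P, x (t + 1) ω = A.toEuclideanLin (x t ω) + C.toEuclideanLin (w (t + 1) ω)
  obs_eq : ∀ t, ∀ᵐ ω ∂P, y t ω = G.toEuclideanLin (x t ω) + v t ω
  memLp_x : ∀ t, MemLp (x t) 2 P
  stationary_x : ∀ s t, IdentDistrib (x s) (x t) P P

section Filter

variable {N M : ℕ} (A C : Matrix (Fin N) (Fin N) ℝ) (G : Matrix (Fin M) (Fin N) ℝ)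
  (R : Matrix (Fin M) (Fin M) ℝ) (S : Matrix (Fin N) (Fin N) ℝ)

/-- The innovation covariance `G Σ Gᵀ + R`. -/
def innovCov : Matrix (Fin M) (Fin M) ℝ :=
  G * S * Gᵀ + R

/-- The Kalman gain `K = A Σ Gᵀ (G Σ Gᵀ + R)⁻¹`. -/
def kalmanGain : Matrix (Fin N) (Fin M) ℝ :=
  A * S * Gᵀ * (innovCov G R S)⁻¹

/-- The Riccati equation `Σ = C Cᵀ + K R Kᵀ + (A - K G) Σ (A - K G)ᵀ`. -/
def Riccati : Prop :=
  S = C * Cᵀ + kalmanGain A G R S * R * (kalmanGain A G R S)ᵀ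
    + (A - kalmanGain A G R S * G) * S * (A - kalmanGain A G R S * G)ᵀ

/-- The coefficient `B_j = G (A - K G)^(j-1) K` of the infinite-order VAR (meant for `1 ≤ j`). -/
def varCoeff (j : ℕ) : Matrix (Fin M) (Fin M) ℝ :=
  G * (A - kalmanGain A G R S * G) ^ (j - 1) * kalmanGain A G R S

end Filter

end

end DFM

/-! Write `F = A - K G`. The Riccati map sends an error covariance to the smallest one reachable in
one step, over all gains; completing the square in the gain shows this. Hence the map is monotone,
and with gain `0` as competitor its iterates from `0` stay below the stationary covariance of `x_t`.
They increase to a fixed point. Every positive semidefinite solution `S` satisfies `S ≥ C Cᵀ > 0`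
and `S - F S Fᵀ ≥ C Cᵀ`, so `S` is a Lyapunov function and `F` is exponentially stable.

Stability makes the filter `∑ F^j K y_{t-1-j}` converge. Its error obeys `e_{t+1} = F e_t + C
w_{t+1} - K v_t`, and its second moments solve linear recursions with a unique bounded two-sided
solution. Thus `E[e eᵀ] = E[e xᵀ] = S`, and `F S Gᵀ = K R` says exactly that `e_{t+1}` is orthogonal
to `y_t`; earlier observations follow by induction. Everything lies in the closed span of the
Gaussian noises, where uncorrelated means independent, so the filter is the conditional expectation
and its expansion is the VAR. Since `S` is then the covariance of a prediction error defined without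
`S`, the solution is unique.

For large `M` the information form with `a = σ²` is decisive: with `Q = (a⁻¹ GᵀG + S⁻¹)⁻¹` one has
`K = a⁻¹ A Q Gᵀ` and `F = A Q S⁻¹`. Here `Q ≤ a (GᵀG)⁻¹ = O(1/M)` and `S⁻¹ ≤ (C Cᵀ)⁻¹`, so `F =
O(1/M)`, while `‖G‖ ‖K‖ = O(1)`. This gives the rate of `G F^(j-1) K`. The error of the first-order
VAR is `G F` applied to the filter at `t - 1`, hence `O(M^(-1/2))` in `L²`, because the second
moment of the state is bounded independently of `M`. -/

namespace DFM

/-! ### Frobenius norm, stable powers and the Loewner order -/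

section LinearAlgebra

variable {m n k : ℕ}

theorem norm_toEuclideanLin_le (A : Matrix (Fin m) (Fin n) ℝ) (u : EuclideanSpace ℝ (Fin n)) :
    ‖A.toEuclideanLin u‖ ≤ ‖A‖ * ‖u‖ := by
  have h := Matrix.frobenius_norm_mul A (Matrix.replicateCol Unit u.ofLp)
  rw [← Matrix.replicateCol_mulVec, Matrix.frobenius_norm_replicateCol,
    Matrix.frobenius_norm_replicateCol] at h
  exact h

theorem toEuclideanLin_mul_apply (A : Matrix (Fin m) (Fin n) ℝ) (B : Matrix (Fin n) (Fin k) ℝ)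
    (u : EuclideanSpace ℝ (Fin k)) :
    (A * B).toEuclideanLin u = A.toEuclideanLin (B.toEuclideanLin u) := by
  simp [Matrix.toLpLin_apply, Matrix.mulVec_mulVec]

theorem toEuclideanLin_apply_coord (A : Matrix (Fin m) (Fin n) ℝ) (u : EuclideanSpace ℝ (Fin n))
    (i : Fin m) : A.toEuclideanLin u i = ∑ j, A i j * u j := by
  simp [Matrix.toLpLin_apply, Matrix.mulVec, dotProduct]

theorem frobenius_norm_sq (A : Matrix (Fin m) (Fin n) ℝ) : ‖A‖ ^ 2 = ∑ i, ∑ j, A i j ^ 2 := by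
  rw [Matrix.frobenius_norm_def, ← Real.sqrt_eq_rpow, Real.sq_sqrt (by positivity)]
  simp

theorem abs_entry_le_frobenius_norm (A : Matrix (Fin m) (Fin n) ℝ) (i : Fin m) (j : Fin n) :
    |A i j| ≤ ‖A‖ := by
  refine abs_le_of_sq_le_sq ?_ (norm_nonneg A)
  rw [frobenius_norm_sq]
  calc A i j ^ 2 ≤ ∑ j, A i j ^ 2 :=
        Finset.single_le_sum (f := fun j => A i j ^ 2) (fun _ _ => sq_nonneg _) (Finset.mem_univ j)
    _ ≤ _ := Finset.single_le_sum (f := fun i => ∑ j, A i j ^ 2)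
        (fun _ _ => Finset.sum_nonneg fun _ _ => sq_nonneg _) (Finset.mem_univ i)

theorem frobenius_norm_le_of_entry_le (A : Matrix (Fin m) (Fin n) ℝ) {c : ℝ} (hc : 0 ≤ c)
    (h : ∀ i j, |A i j| ≤ c) : ‖A‖ ≤ √(m * n) * c := by
  refine le_of_sq_le_sq ?_ (by positivity)
  rw [frobenius_norm_sq, mul_pow, Real.sq_sqrt (by positivity)]
  calc ∑ i, ∑ j, A i j ^ 2 ≤ ∑ i : Fin m, ∑ j : Fin n, c ^ 2 :=
        Finset.sum_le_sum fun i _ => Finset.sum_le_sum fun j _ => sq_le_sq' (abs_le.1 (h i j)).1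
          (abs_le.1 (h i j)).2
    _ = _ := by simp; ring

/-- Gelfand's formula applied to the complexification, which has the same Frobenius norms of powers.
-/
theorem IsStable.tendsto_norm_pow {A : Matrix (Fin n) (Fin n) ℝ} (hA : IsStable A) :
    Tendsto (fun k : ℕ => ‖A ^ k‖) atTop (𝓝 0) := by
  rcases Nat.eq_zero_or_pos n with rfl | hn
  · simp [Subsingleton.elim _ (0 : Matrix (Fin 0) (Fin 0) ℝ)]
  have : Nonempty (Fin n) := ⟨⟨0, hn⟩⟩
  set B : Matrix (Fin n) (Fin n) ℂ := A.map (algebraMap ℝ ℂ) with hB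
  have hnorm : ∀ k : ℕ, ‖A ^ k‖ = ‖B ^ k‖ := by
    intro k
    have : B ^ k = (A ^ k).map (algebraMap ℝ ℂ) := by
      have := (map_pow ((algebraMap ℝ ℂ).mapMatrix (m := Fin n)) A k)
      simpa [hB] using this.symm
    rw [this, Matrix.frobenius_norm_map_eq _ _ (fun a => by simp)]
  have : CompleteSpace (Matrix (Fin n) (Fin n) ℂ) := FiniteDimensional.complete ℂ _
  have hr : spectralRadius ℂ B < (1 : NNReal) := by
    refine spectrum.spectralRadius_lt_of_forall_lt B fun z hz => ?_
    have := hA z hz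
    exact_mod_cast this
  obtain ⟨r, hr1, hr2⟩ := ENNReal.lt_iff_exists_nnreal_btwn.1 hr
  have hlim := spectrum.pow_nnnorm_pow_one_div_tendsto_nhds_spectralRadius B
  have hr2' : r < 1 := by exact_mod_cast hr2
  have hev : ∀ᶠ k : ℕ in atTop, ‖A ^ k‖ ≤ (r : ℝ) ^ k := by
    filter_upwards [hlim.eventually_lt_const hr1, eventually_gt_atTop 0] with k hk hk0
    rw [hnorm]
    have h1 := ENNReal.rpow_le_rpow hk.le (Nat.cast_nonneg (α := ℝ) k)
    rw [← ENNReal.rpow_mul, one_div, inv_mul_cancel₀ (by positivity), ENNReal.rpow_one,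
      ENNReal.rpow_natCast] at h1
    exact_mod_cast h1
  exact squeeze_zero' (Eventually.of_forall fun _ => norm_nonneg _) hev
    (tendsto_pow_atTop_nhds_zero_of_lt_one r.2 hr2')

theorem quadForm_toEuclideanLin (A : Matrix (Fin m) (Fin n) ℝ) (u : Fin n → ℝ) :
    u ⬝ᵥ ((Aᵀ * A) *ᵥ u) = ‖A.toEuclideanLin (WithLp.toLp 2 u)‖ ^ 2 := by
  rw [← Matrix.mulVec_mulVec, Matrix.dotProduct_mulVec, Matrix.vecMul_transpose,
    EuclideanSpace.real_norm_sq_eq]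
  simp [Matrix.toLpLin_apply, dotProduct, sq]

theorem abs_quadForm_le (A : Matrix (Fin n) (Fin n) ℝ) (u : Fin n → ℝ) :
    |u ⬝ᵥ (A *ᵥ u)| ≤ ‖A‖ * (u ⬝ᵥ u) := by
  have h : u ⬝ᵥ (A *ᵥ u) = inner ℝ (WithLp.toLp 2 u) (A.toEuclideanLin (WithLp.toLp 2 u)) := by
    simp [PiLp.inner_apply, Matrix.toLpLin_apply, dotProduct, mul_comm]
  have h2 : u ⬝ᵥ u = ‖WithLp.toLp 2 u‖ ^ 2 := by
    rw [EuclideanSpace.real_norm_sq_eq]; simp [dotProduct, sq]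
  rw [h, h2]
  calc _ ≤ ‖WithLp.toLp 2 u‖ * ‖A.toEuclideanLin (WithLp.toLp 2 u)‖ := abs_real_inner_le_norm _ _
    _ ≤ ‖WithLp.toLp 2 u‖ * (‖A‖ * ‖WithLp.toLp 2 u‖) := by
        gcongr; exact norm_toEuclideanLin_le _ _
    _ = _ := by ring

theorem posSemidef_iff_real {A : Matrix (Fin n) (Fin n) ℝ} :
    A.PosSemidef ↔ Aᵀ = A ∧ ∀ u : Fin n → ℝ, 0 ≤ u ⬝ᵥ (A *ᵥ u) := by
  rw [Matrix.posSemidef_iff_dotProduct_mulVec]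
  simp [Matrix.IsHermitian, Matrix.conjTranspose_eq_transpose_of_trivial]

theorem _root_.Matrix.PosSemidef.mul_mul_transpose {A : Matrix (Fin n) (Fin n) ℝ}
    (hA : A.PosSemidef) (B : Matrix (Fin m) (Fin n) ℝ) : (B * A * Bᵀ).PosSemidef := by
  simpa [Matrix.conjTranspose_eq_transpose_of_trivial] using hA.mul_mul_conjTranspose_same B

/-- The form evaluated at `e_i + s e_j` is a nonnegative quadratic polynomial in `s`, so its
discriminant is nonpositive. -/
theorem _root_.Matrix.PosSemidef.sq_entry_le {A : Matrix (Fin n) (Fin n) ℝ}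
    (hA : A.PosSemidef) (i j : Fin n) : A i j ^ 2 ≤ A i i * A j j := by
  have hsymm : A j i = A i j := congrFun (congrFun (posSemidef_iff_real.1 hA).1 i) j
  have hq : ∀ s : ℝ, 0 ≤ A j j * (s * s) + (2 * A i j) * s + A i i := by
    intro s
    have := (posSemidef_iff_real.1 hA).2 (Pi.single i 1 + s • Pi.single j 1)
    simp [Matrix.mulVec_add, Matrix.mulVec_smul, add_dotProduct, dotProduct_add, hsymm] at this
    linarith
  have := discrim_le_zero hq
  rw [discrim] at this
  nlinarith

theorem _root_.Matrix.PosSemidef.frobenius_norm_le_trace {A : Matrix (Fin n) (Fin n) ℝ}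
    (hA : A.PosSemidef) : ‖A‖ ≤ A.trace := by
  refine le_of_sq_le_sq ?_ hA.trace_nonneg
  rw [frobenius_norm_sq, sq, Matrix.trace, Finset.sum_mul_sum]
  exact Finset.sum_le_sum fun i _ => Finset.sum_le_sum fun j _ => hA.sq_entry_le i j

theorem trace_le_card_mul_norm (A : Matrix (Fin n) (Fin n) ℝ) : A.trace ≤ n * ‖A‖ := by
  calc A.trace ≤ ∑ _i : Fin n, ‖A‖ :=
        Finset.sum_le_sum fun i _ => (le_abs_self _).trans (abs_entry_le_frobenius_norm A i i)
    _ = n * ‖A‖ := by simp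

/-- Inversion is antitone on positive definite matrices. -/
theorem posSemidef_inv_sub_inv_add {X Y : Matrix (Fin n) (Fin n) ℝ} (hX : X.PosDef)
    (hY : Y.PosSemidef) : (X⁻¹ - (X + Y)⁻¹).PosSemidef := by
  have hZ := hX.add_posSemidef hY
  have hXu := (Matrix.isUnit_iff_isUnit_det _).1 hX.isUnit
  have hZu := (Matrix.isUnit_iff_isUnit_det _).1 hZ.isUnit
  have hYt := (posSemidef_iff_real.1 hY).1
  have hXt := (posSemidef_iff_real.1 hX.posSemidef).1
  -- With `Z = X + Y`, the difference `X⁻¹ - Z⁻¹` is the congruence `Z⁻¹ (Y + Y X⁻¹ Y) Z⁻¹`.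
  have h1 : (Y + Y * X⁻¹ * Yᵀ).PosSemidef :=
    hY.add (hX.inv.posSemidef.mul_mul_transpose Y)
  have h2 := h1.mul_mul_transpose (X + Y)⁻¹
  convert h2 using 1
  rw [Matrix.transpose_nonsing_inv, Matrix.transpose_add, hYt, hXt]
  have h3 : Y + Y * X⁻¹ * Y = (X + Y) * X⁻¹ * (X + Y) - (X + Y) := by
    have := Matrix.mul_nonsing_inv X hXu
    have h' := Matrix.nonsing_inv_mul X hXu
    rw [add_mul, this, add_mul, mul_add (Y * X⁻¹), Matrix.mul_assoc Y X⁻¹ X, h']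
    simp
  have h4 := Matrix.mul_nonsing_inv (X + Y) hZu
  have h5 := Matrix.nonsing_inv_mul (X + Y) hZu
  rw [h3, mul_sub, h5, sub_mul, one_mul, ← mul_assoc, ← mul_assoc, h5, one_mul, mul_assoc, h4,
    mul_one]

/-- On positive semidefinite matrices the Frobenius norm is at most the trace, and the trace is
monotone; returning from trace to norm costs the factor `n`. -/
theorem norm_inv_add_le {X Y : Matrix (Fin n) (Fin n) ℝ} (hX : X.PosDef)
    (hY : Y.PosSemidef) : ‖(X + Y)⁻¹‖ ≤ n * ‖X⁻¹‖ := by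
  have h := (posSemidef_inv_sub_inv_add hX hY).trace_nonneg
  rw [Matrix.trace_sub] at h
  have h1 := (hX.add_posSemidef hY).inv.posSemidef.frobenius_norm_le_trace
  have h2 := trace_le_card_mul_norm X⁻¹
  linarith

end LinearAlgebra


/-! ### The Riccati equation: existence of a solution and closed-loop stability -/

section RiccatiTheory

variable {N M : ℕ} {A C : Matrix (Fin N) (Fin N) ℝ} {G : Matrix (Fin M) (Fin N) ℝ}
  {R : Matrix (Fin M) (Fin M) ℝ} {S T : Matrix (Fin N) (Fin N) ℝ}

/-- The error covariance after one step of the observer with gain `K`. -/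
def gainStep (A C : Matrix (Fin N) (Fin N) ℝ) (G : Matrix (Fin M) (Fin N) ℝ)
    (R : Matrix (Fin M) (Fin M) ℝ) (K : Matrix (Fin N) (Fin M) ℝ) (S : Matrix (Fin N) (Fin N) ℝ) :
    Matrix (Fin N) (Fin N) ℝ :=
  C * Cᵀ + K * R * Kᵀ + (A - K * G) * S * (A - K * G)ᵀ

/-- The Riccati map `S ↦ C Cᵀ + K R Kᵀ + (A - K G) S (A - K G)ᵀ`, with `K` the Kalman gain. -/
noncomputable def riccatiMap (A C : Matrix (Fin N) (Fin N) ℝ) (G : Matrix (Fin M) (Fin N) ℝ)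
    (R : Matrix (Fin M) (Fin M) ℝ) (S : Matrix (Fin N) (Fin N) ℝ) : Matrix (Fin N) (Fin N) ℝ :=
  gainStep A C G R (kalmanGain A G R S) S

theorem innovCov_posDef (hR : R.PosDef) (hS : S.PosSemidef) : (innovCov G R S).PosDef :=
  hR.posSemidef_add (hS.mul_mul_transpose G)

theorem kalmanGain_mul_innovCov (hR : R.PosDef) (hS : S.PosSemidef) :
    kalmanGain A G R S * innovCov G R S = A * S * Gᵀ := by
  have h := (Matrix.isUnit_iff_isUnit_det _).1 (innovCov_posDef (G := G) hR hS).isUnit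
  rw [kalmanGain, Matrix.mul_assoc, Matrix.nonsing_inv_mul _ h, Matrix.mul_one]

theorem innovCov_mul_kalmanGain_transpose (hR : R.PosDef) (hS : S.PosSemidef) :
    innovCov G R S * (kalmanGain A G R S)ᵀ = G * S * Aᵀ := by
  have h := congrArg Matrix.transpose (kalmanGain_mul_innovCov (A := A) (G := G) hR hS)
  rw [Matrix.transpose_mul, (posSemidef_iff_real.1 (innovCov_posDef hR hS).posSemidef).1] at h
  rw [h, Matrix.transpose_mul, Matrix.transpose_mul, (posSemidef_iff_real.1 hS).1,
    Matrix.transpose_transpose, Matrix.mul_assoc]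

/-- `(A - K G) S Gᵀ = K R` for the Kalman gain `K`. -/
theorem closedLoop_mul_eq_gain_mul (hR : R.PosDef) (hS : S.PosSemidef) :
    (A - kalmanGain A G R S * G) * S * Gᵀ = kalmanGain A G R S * R := by
  have h := kalmanGain_mul_innovCov (A := A) (G := G) hR hS
  rw [innovCov, Matrix.mul_add] at h
  rw [Matrix.sub_mul, Matrix.sub_mul, ← h]
  simp only [Matrix.mul_assoc]
  abel

theorem gainStep_eq (K : Matrix (Fin N) (Fin M) ℝ) :
    gainStep A C G R K S = C * Cᵀ + A * S * Aᵀ - K * (G * S * Aᵀ) - A * S * Gᵀ * Kᵀ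
      + K * innovCov G R S * Kᵀ := by
  rw [gainStep, innovCov]
  simp only [Matrix.transpose_sub, Matrix.transpose_mul, Matrix.sub_mul, Matrix.mul_sub,
    Matrix.add_mul, Matrix.mul_add, Matrix.mul_assoc]
  abel

/-- Completing the square in the gain. -/
theorem gainStep_eq_riccatiMap_add (hR : R.PosDef) (hS : S.PosSemidef)
    (K : Matrix (Fin N) (Fin M) ℝ) :
    gainStep A C G R K S = riccatiMap A C G R S +
      (K - kalmanGain A G R S) * innovCov G R S * (K - kalmanGain A G R S)ᵀ := by
  have h1 := kalmanGain_mul_innovCov (A := A) (G := G) hR hS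
  have h2 := innovCov_mul_kalmanGain_transpose (A := A) (G := G) hR hS
  rw [riccatiMap, gainStep_eq, gainStep_eq, ← h1, ← h2]
  simp only [Matrix.transpose_sub, Matrix.sub_mul, Matrix.mul_sub, Matrix.mul_assoc]
  abel

/-- The completed square is positive semidefinite: the Kalman gain is optimal in the Loewner order.
-/
theorem riccatiMap_le_gainStep (hR : R.PosDef) (hS : S.PosSemidef) (K : Matrix (Fin N) (Fin M) ℝ) :
    (gainStep A C G R K S - riccatiMap A C G R S).PosSemidef := by
  rw [gainStep_eq_riccatiMap_add hR hS, add_sub_cancel_left]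
  exact (innovCov_posDef hR hS).posSemidef.mul_mul_transpose _

theorem posSemidef_mul_transpose (B : Matrix (Fin N) (Fin M) ℝ) : (B * Bᵀ).PosSemidef := by
  simpa using Matrix.posSemidef_self_mul_conjTranspose B

theorem gainStep_posSemidef (hR : R.PosDef) (hS : S.PosSemidef) (K : Matrix (Fin N) (Fin M) ℝ) :
    (gainStep A C G R K S).PosSemidef :=
  ((posSemidef_mul_transpose C).add (hR.posSemidef.mul_mul_transpose K)).add
    (hS.mul_mul_transpose _)

theorem riccatiMap_posSemidef (hR : R.PosDef) (hS : S.PosSemidef) :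
    (riccatiMap A C G R S).PosSemidef :=
  gainStep_posSemidef hR hS _

/-- Freeze the gain that is optimal for `T`: at fixed gain the step is monotone in the covariance,
and at `S` this gain can only do worse than the optimal one. -/
theorem riccatiMap_mono (hR : R.PosDef) (hS : S.PosSemidef)
    (hST : (T - S).PosSemidef) :
    (riccatiMap A C G R T - riccatiMap A C G R S).PosSemidef := by
  set K := kalmanGain A G R T
  have h1 := riccatiMap_le_gainStep (A := A) (C := C) (G := G) hR hS K
  have h2 : (gainStep A C G R K T - gainStep A C G R K S).PosSemidef := by
    convert hST.mul_mul_transpose (A - K * G) using 1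
    simp only [gainStep, Matrix.mul_sub, Matrix.sub_mul]
    abel
  convert h2.add h1 using 1
  rw [riccatiMap]
  abel

/-- Comparison with the gain `0`, that is, with ignoring the observations. -/
theorem riccatiMap_le_lyapunov (hR : R.PosDef) (hS : S.PosSemidef) :
    (C * Cᵀ + A * S * Aᵀ - riccatiMap A C G R S).PosSemidef := by
  simpa [gainStep] using riccatiMap_le_gainStep (A := A) (C := C) (G := G) hR hS 0

theorem tendsto_matrix_mul {k m n : ℕ} {X : ℕ → Matrix (Fin k) (Fin m) ℝ}
    {Y : ℕ → Matrix (Fin m) (Fin n) ℝ} {X₀ : Matrix (Fin k) (Fin m) ℝ}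
    {Y₀ : Matrix (Fin m) (Fin n) ℝ} (hX : Tendsto X atTop (𝓝 X₀)) (hY : Tendsto Y atTop (𝓝 Y₀)) :
    Tendsto (fun l => X l * Y l) atTop (𝓝 (X₀ * Y₀)) := by
  refine tendsto_pi_nhds.2 fun i => tendsto_pi_nhds.2 fun j => ?_
  simp only [Matrix.mul_apply]
  exact tendsto_finsetSum _ fun l _ =>
    (tendsto_pi_nhds.1 (tendsto_pi_nhds.1 hX i) l).mul (tendsto_pi_nhds.1 (tendsto_pi_nhds.1 hY l) j)

theorem tendsto_riccatiMap (hR : R.PosDef) (hS : S.PosSemidef)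
    {T : ℕ → Matrix (Fin N) (Fin N) ℝ} (hT : Tendsto T atTop (𝓝 S)) :
    Tendsto (fun n => riccatiMap A C G R (T n)) atTop (𝓝 (riccatiMap A C G R S)) := by
  have hV : Tendsto (fun n => innovCov G R (T n)) atTop (𝓝 (innovCov G R S)) := by
    have : Continuous fun X : Matrix (Fin N) (Fin N) ℝ => innovCov G R X := by
      unfold innovCov; fun_prop
    exact (this.tendsto S).comp hT
  have hVi : Tendsto (fun n => (innovCov G R (T n))⁻¹) atTop (𝓝 (innovCov G R S)⁻¹) := by
    have hu := (innovCov_posDef (G := G) hR hS).isUnit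
    have hdet : (innovCov G R S).det ≠ 0 := ((Matrix.isUnit_iff_isUnit_det _).1 hu).ne_zero
    have hc1 : Continuous fun X : Matrix (Fin M) (Fin M) ℝ => X.det := by fun_prop
    have hc2 : Continuous fun X : Matrix (Fin M) (Fin M) ℝ => X.adjugate :=
      continuous_id.matrix_adjugate
    -- The inverse is the adjugate over the determinant, continuous where the determinant is
    -- nonzero.
    simp only [Matrix.inv_def, Ring.inverse_eq_inv']
    exact (((hc1.tendsto _).comp hV).inv₀ hdet).smul ((hc2.tendsto _).comp hV)
  have hK : Tendsto (fun n => kalmanGain A G R (T n)) atTop (𝓝 (kalmanGain A G R S)) := by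
    simp only [kalmanGain]
    exact tendsto_matrix_mul (tendsto_matrix_mul (tendsto_matrix_mul tendsto_const_nhds hT)
      tendsto_const_nhds) hVi
  have hKt : Tendsto (fun n => (kalmanGain A G R (T n))ᵀ) atTop (𝓝 (kalmanGain A G R S)ᵀ) :=
    (continuous_id.matrix_transpose.tendsto _).comp hK
  have hF : Tendsto (fun n => A - kalmanGain A G R (T n) * G) atTop
      (𝓝 (A - kalmanGain A G R S * G)) :=
    tendsto_const_nhds.sub (tendsto_matrix_mul hK tendsto_const_nhds)
  have hFt : Tendsto (fun n => (A - kalmanGain A G R (T n) * G)ᵀ) atTop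
      (𝓝 (A - kalmanGain A G R S * G)ᵀ) :=
    (continuous_id.matrix_transpose.tendsto _).comp hF
  simp only [riccatiMap, gainStep]
  exact (tendsto_const_nhds.add (tendsto_matrix_mul
    (tendsto_matrix_mul hK tendsto_const_nhds) hKt)).add
      (tendsto_matrix_mul (tendsto_matrix_mul hF hT) hFt)

/-- A bounded increasing sequence of positive semidefinite matrices converges to a positive
semidefinite matrix. -/
theorem exists_tendsto_of_monotone_posSemidef {T : ℕ → Matrix (Fin N) (Fin N) ℝ}
    {U : Matrix (Fin N) (Fin N) ℝ} (hT : ∀ n, (T n).PosSemidef)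
    (hmono : ∀ n, (T (n + 1) - T n).PosSemidef) (hbdd : ∀ n, (U - T n).PosSemidef) :
    ∃ S : Matrix (Fin N) (Fin N) ℝ, S.PosSemidef ∧ Tendsto T atTop (𝓝 S) := by
  have hq : ∀ u : Fin N → ℝ, ∃ l, Tendsto (fun n => u ⬝ᵥ (T n *ᵥ u)) atTop (𝓝 l) := by
    intro u
    refine ⟨_, tendsto_atTop_ciSup (monotone_nat_of_le_succ fun n => ?_)
      ⟨u ⬝ᵥ (U *ᵥ u), ?_⟩⟩
    · have := (posSemidef_iff_real.1 (hmono n)).2 u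
      rw [Matrix.sub_mulVec, dotProduct_sub] at this
      linarith
    · rintro _ ⟨n, rfl⟩
      have := (posSemidef_iff_real.1 (hbdd n)).2 u
      rw [Matrix.sub_mulVec, dotProduct_sub] at this
      simpa using this
  choose q hq using hq
  -- Polarisation transfers convergence from the quadratic forms to the entries.
  have hentry : ∀ n i j, T n i j = ((Pi.single i 1 + Pi.single j 1) ⬝ᵥ
      (T n *ᵥ (Pi.single i 1 + Pi.single j 1)) - Pi.single i 1 ⬝ᵥ (T n *ᵥ Pi.single i 1)
      - Pi.single j 1 ⬝ᵥ (T n *ᵥ Pi.single j 1)) / 2 := by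
    intro n i j
    have hsymm : T n j i = T n i j := congrFun (congrFun (posSemidef_iff_real.1 (hT n)).1 i) j
    simp [Matrix.mulVec_add, add_dotProduct, dotProduct_add, hsymm]
    ring
  set S : Matrix (Fin N) (Fin N) ℝ := Matrix.of fun i j =>
    (q (Pi.single i 1 + Pi.single j 1) - q (Pi.single i 1) - q (Pi.single j 1)) / 2 with hSdef
  have hlim : Tendsto T atTop (𝓝 S) := by
    refine tendsto_pi_nhds.2 fun i => tendsto_pi_nhds.2 fun j => ?_
    simp_rw [hentry _ i j]
    exact (((hq _).sub (hq _)).sub (hq _)).div_const 2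
  refine ⟨S, posSemidef_iff_real.2 ⟨?_, fun u => ?_⟩, hlim⟩
  · ext i j
    simp only [hSdef, Matrix.transpose_apply, Matrix.of_apply]
    rw [add_comm (Pi.single j 1)]
    ring
  · have hc : Continuous fun X : Matrix (Fin N) (Fin N) ℝ => u ⬝ᵥ (X *ᵥ u) := by fun_prop
    exact ge_of_tendsto' ((hc.tendsto S).comp hlim) fun n => (posSemidef_iff_real.1 (hT n)).2 u

/-- The iterates from `0` increase by monotonicity of the map and are bounded by the Lyapunov
solution `U`; by continuity their limit is a fixed point. -/
theorem exists_riccati_solution (hR : R.PosDef) {U : Matrix (Fin N) (Fin N) ℝ}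
    (hU : U.PosSemidef) (hUeq : U = A * U * Aᵀ + C * Cᵀ) :
    ∃ S : Matrix (Fin N) (Fin N) ℝ, S.PosSemidef ∧ Riccati A C G R S := by
  set T : ℕ → Matrix (Fin N) (Fin N) ℝ := fun n => (riccatiMap A C G R)^[n] 0 with hTdef
  have hsucc : ∀ n, T (n + 1) = riccatiMap A C G R (T n) := fun n =>
    Function.iterate_succ_apply' _ _ _
  have hT : ∀ n, (T n).PosSemidef := by
    intro n
    induction n with
    | zero => exact Matrix.PosSemidef.zero
    | succ n ih => rw [hsucc]; exact riccatiMap_posSemidef hR ih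
  have hmono : ∀ n, (T (n + 1) - T n).PosSemidef := by
    intro n
    induction n with
    | zero => simpa [hTdef] using hT 1
    | succ n ih =>
      simpa only [← hsucc] using riccatiMap_mono (A := A) (C := C) (G := G) hR (hT n) ih
  have hbdd : ∀ n, (U - T n).PosSemidef := by
    intro n
    induction n with
    | zero => simpa [hTdef] using hU
    | succ n ih =>
      -- Here `U - T (n+1)` is the sum of `C Cᵀ + A T_n Aᵀ - T (n+1)` and `A (U - T_n) Aᵀ`.
      have h1 := riccatiMap_le_lyapunov (A := A) (C := C) (G := G) hR (hT n)
      have h2 := ih.mul_mul_transpose A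
      convert h1.add h2 using 1
      rw [hsucc, Matrix.mul_sub, Matrix.sub_mul]
      nth_rw 1 [hUeq]
      abel
  obtain ⟨S, hS, hlim⟩ := exists_tendsto_of_monotone_posSemidef hT hmono hbdd
  refine ⟨S, hS, ?_⟩
  have h1 := tendsto_riccatiMap (A := A) (C := C) (G := G) hR hS hlim
  have h2 : Tendsto (fun n => riccatiMap A C G R (T n)) atTop (𝓝 S) := by
    simp_rw [← hsucc]
    exact (tendsto_add_atTop_iff_nat 1).2 hlim
  exact tendsto_nhds_unique h2 h1

section Solution

variable (hR : R.PosDef) (hC : IsUnit C) (hS : S.PosSemidef) (hRic : Riccati A C G R S)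

theorem posDef_mul_transpose_of_isUnit (hC : IsUnit C) : (C * Cᵀ).PosDef := by
  have := Matrix.PosDef.mul_conjTranspose_self C (Matrix.vecMul_injective_of_isUnit hC)
  simpa using this

include hR hC hS hRic in
theorem Riccati.posDef : S.PosDef := by
  rw [hRic, add_assoc]
  exact (posDef_mul_transpose_of_isUnit hC).add_posSemidef
    ((hR.posSemidef.mul_mul_transpose _).add (hS.mul_mul_transpose _))

include hR hS hRic in
theorem Riccati.sub_posSemidef : (S - C * Cᵀ).PosSemidef := by
  have : S - C * Cᵀ = kalmanGain A G R S * R * (kalmanGain A G R S)ᵀ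
    + (A - kalmanGain A G R S * G) * S * (A - kalmanGain A G R S * G)ᵀ := by
    rw [sub_eq_iff_eq_add, add_comm, ← add_assoc]
    exact hRic
  rw [this]
  exact (hR.posSemidef.mul_mul_transpose _).add (hS.mul_mul_transpose _)

include hR hS hRic in
/-- The Riccati equation in the form `S = C Cᵀ + (A - K G) S Aᵀ`. -/
theorem Riccati.eq_closedLoop :
    S = C * Cᵀ + (A - kalmanGain A G R S * G) * S * Aᵀ := by
  have h := closedLoop_mul_eq_gain_mul (A := A) (G := G) hR hS
  have h2 : S = C * Cᵀ + kalmanGain A G R S * R * (kalmanGain A G R S)ᵀ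
    + (A - kalmanGain A G R S * G) * S * (A - kalmanGain A G R S * G)ᵀ := hRic
  conv_lhs => rw [h2, ← h]
  rw [Matrix.transpose_sub, Matrix.transpose_mul, Matrix.mul_sub]
  simp only [Matrix.mul_assoc]
  abel

theorem exists_pos_le_quadForm (hC : IsUnit C) :
    ∃ c : ℝ, 0 < c ∧ ∀ u : Fin N → ℝ, c * (u ⬝ᵥ u) ≤ u ⬝ᵥ ((C * Cᵀ) *ᵥ u) := by
  -- From `u = (Cᵀ)⁻¹ Cᵀ u`; the summand `1` keeps the constant positive even in dimension zero.
  refine ⟨(‖(Cᵀ)⁻¹‖ ^ 2 + 1)⁻¹, by positivity, fun u => ?_⟩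
  rw [inv_mul_le_iff₀ (by positivity)]
  have h := quadForm_toEuclideanLin Cᵀ u
  rw [Matrix.transpose_transpose] at h
  have h2 : u ⬝ᵥ u = ‖WithLp.toLp 2 u‖ ^ 2 := by
    rw [EuclideanSpace.real_norm_sq_eq]; simp [dotProduct, sq]
  have hdet : IsUnit (Cᵀ).det := by
    rw [Matrix.det_transpose]; exact (Matrix.isUnit_iff_isUnit_det _).1 hC
  have h3 : WithLp.toLp 2 u =
      ((Cᵀ)⁻¹).toEuclideanLin ((Cᵀ).toEuclideanLin (WithLp.toLp 2 u)) := by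
    rw [← toEuclideanLin_mul_apply, Matrix.nonsing_inv_mul _ hdet]
    simp
  have h4 := norm_toEuclideanLin_le (Cᵀ)⁻¹ ((Cᵀ).toEuclideanLin (WithLp.toLp 2 u))
  rw [← h3] at h4
  rw [h, h2]
  have h5 := pow_le_pow_left₀ (norm_nonneg _) h4 2
  rw [mul_pow] at h5
  nlinarith [sq_nonneg ‖(Cᵀ).toEuclideanLin (WithLp.toLp 2 u)‖]

include hR hC hS hRic in
/-- The closed-loop matrix `A - K G` of a positive semidefinite solution is exponentially stable. -/
theorem Riccati.exists_norm_pow_le :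
    ∃ c r : ℝ, 0 ≤ c ∧ 0 ≤ r ∧ r < 1 ∧
      ∀ k : ℕ, ‖(A - kalmanGain A G R S * G) ^ k‖ ≤ c * r ^ k := by
  set F := A - kalmanGain A G R S * G with hF
  obtain ⟨c, hc, hcq⟩ := exists_pos_le_quadForm hC
  have hSq : ∀ u : Fin N → ℝ, c * (u ⬝ᵥ u) ≤ u ⬝ᵥ (S *ᵥ u) := by
    intro u
    have := (posSemidef_iff_real.1 (hRic.sub_posSemidef hR hS)).2 u
    rw [Matrix.sub_mulVec, dotProduct_sub] at this
    linarith [hcq u]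
  -- Since `C Cᵀ ≥ c I` and `S ≤ ‖S‖ I`, this `d` gives `C Cᵀ ≥ d S` and hence the contraction `F S
  -- Fᵀ ≤ (1 - d) S`. Adding `c` to the denominator ensures `0 < d ≤ 1`.
  set d : ℝ := c / (‖S‖ + c) with hd
  have hden : 0 < ‖S‖ + c := by positivity
  have hd0 : 0 < d := by positivity
  have hd1 : d ≤ 1 := by
    rw [hd, div_le_one hden]; linarith [norm_nonneg S]
  have hstep : ∀ u : Fin N → ℝ, u ⬝ᵥ ((F * S * Fᵀ) *ᵥ u) ≤ (1 - d) * (u ⬝ᵥ (S *ᵥ u)) := by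
    intro u
    have h1 : S - C * Cᵀ - F * S * Fᵀ = kalmanGain A G R S * R * (kalmanGain A G R S)ᵀ := by
      rw [sub_sub, sub_eq_iff_eq_add]
      have h2 : S = C * Cᵀ + kalmanGain A G R S * R * (kalmanGain A G R S)ᵀ + F * S * Fᵀ := hRic
      nth_rw 1 [h2]
      abel
    have h3 := (posSemidef_iff_real.1
      (hR.posSemidef.mul_mul_transpose (kalmanGain A G R S))).2 u
    rw [← h1, Matrix.sub_mulVec, Matrix.sub_mulVec, dotProduct_sub, dotProduct_sub] at h3
    have h4 : d * (u ⬝ᵥ (S *ᵥ u)) ≤ u ⬝ᵥ ((C * Cᵀ) *ᵥ u) := by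
      refine le_trans ?_ (hcq u)
      have h5 := (le_abs_self _).trans (abs_quadForm_le S u)
      have h6 : 0 ≤ u ⬝ᵥ u := by simpa using dotProduct_star_self_nonneg u
      rw [hd, div_mul_eq_mul_div, div_le_iff₀ hden]
      nlinarith [mul_nonneg hc.le h6]
    linarith
  have hpow : ∀ (k : ℕ) (u : Fin N → ℝ),
      u ⬝ᵥ ((F ^ k * S * (F ^ k)ᵀ) *ᵥ u) ≤ (1 - d) ^ k * (u ⬝ᵥ (S *ᵥ u)) := by
    intro k
    induction k with
    | zero => intro u; simp
    | succ k ih =>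
      intro u
      have h1 : u ⬝ᵥ ((F ^ (k + 1) * S * (F ^ (k + 1))ᵀ) *ᵥ u) =
          (Fᵀ *ᵥ u) ⬝ᵥ ((F ^ k * S * (F ^ k)ᵀ) *ᵥ (Fᵀ *ᵥ u)) := by
        rw [pow_succ', Matrix.transpose_mul, Matrix.mulVec_transpose F u,
          ← Matrix.dotProduct_mulVec, ← Matrix.mulVec_transpose F u, Matrix.mulVec_mulVec,
          Matrix.mulVec_mulVec]
        simp only [Matrix.mul_assoc]
      have h2 : (Fᵀ *ᵥ u) ⬝ᵥ (S *ᵥ (Fᵀ *ᵥ u)) = u ⬝ᵥ ((F * S * Fᵀ) *ᵥ u) := by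
        rw [Matrix.mulVec_transpose F u,
          ← Matrix.dotProduct_mulVec, ← Matrix.mulVec_transpose F u, Matrix.mulVec_mulVec,
          Matrix.mulVec_mulVec]
      rw [h1]
      refine (ih _).trans ?_
      rw [h2, pow_succ, mul_assoc ((1 - d) ^ k)]
      have hd2 : 0 ≤ 1 - d := by linarith
      exact mul_le_mul_of_nonneg_left (hstep u) (pow_nonneg hd2 _)
  -- Testing `c I ≤ S` on each row of `F ^ k` and summing over the rows turns the contraction of
  -- forms into a bound on the Frobenius norm.
  have hnorm : ∀ k : ℕ, ‖F ^ k‖ ^ 2 ≤ (S.trace / c) * (1 - d) ^ k := by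
    intro k
    rw [div_mul_eq_mul_div, le_div_iff₀ hc]
    have h1 : ∀ i, c * ∑ j, (F ^ k) i j ^ 2 ≤ (1 - d) ^ k * S i i := by
      intro i
      have h2 := hpow k (Pi.single i 1)
      have h3 := hSq ((F ^ k)ᵀ *ᵥ Pi.single i 1)
      have h4 : ((F ^ k)ᵀ *ᵥ Pi.single i 1) ⬝ᵥ (S *ᵥ ((F ^ k)ᵀ *ᵥ Pi.single i 1)) =
          Pi.single i 1 ⬝ᵥ ((F ^ k * S * (F ^ k)ᵀ) *ᵥ Pi.single i 1) := by
        rw [Matrix.mulVec_transpose (F ^ k) _,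
          ← Matrix.dotProduct_mulVec, ← Matrix.mulVec_transpose (F ^ k) _, Matrix.mulVec_mulVec,
          Matrix.mulVec_mulVec]
      have h5 : ((F ^ k)ᵀ *ᵥ Pi.single i 1) ⬝ᵥ ((F ^ k)ᵀ *ᵥ Pi.single i 1) =
          ∑ j, (F ^ k) i j ^ 2 := by
        simp [dotProduct, sq, -Matrix.transpose_pow]
      rw [h4, h5] at h3
      refine h3.trans (h2.trans (le_of_eq ?_))
      simp
    calc ‖F ^ k‖ ^ 2 * c = ∑ i, c * ∑ j, (F ^ k) i j ^ 2 := by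
          rw [frobenius_norm_sq, mul_comm, Finset.mul_sum]
      _ ≤ ∑ i, (1 - d) ^ k * S i i := Finset.sum_le_sum fun i _ => h1 i
      _ = S.trace * (1 - d) ^ k := by
          rw [← Finset.mul_sum, mul_comm]; rfl
  refine ⟨√(S.trace / c), √(1 - d), Real.sqrt_nonneg _, Real.sqrt_nonneg _, ?_, fun k => ?_⟩
  · rw [Real.sqrt_lt' one_pos]; linarith
  · refine le_of_sq_le_sq ?_ (by positivity)
    rw [mul_pow, Real.sq_sqrt (div_nonneg hS.trace_nonneg hc.le), ← pow_mul, mul_comm k 2,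
      pow_mul, Real.sq_sqrt (by linarith)]
    exact hnorm k

end Solution

end RiccatiTheory


/-! ### Information form of the gain and bounds for fixed `M` -/

section Gain

variable {N M : ℕ} {A C : Matrix (Fin N) (Fin N) ℝ} {G : Matrix (Fin M) (Fin N) ℝ}
  {a : ℝ} {S : Matrix (Fin N) (Fin N) ℝ}

theorem posDef_smul_one (ha : 0 < a) : (a • (1 : Matrix (Fin M) (Fin M) ℝ)).PosDef :=
  Matrix.PosDef.one.smul ha

theorem posSemidef_transpose_mul_self (G : Matrix (Fin M) (Fin N) ℝ) : (Gᵀ * G).PosSemidef := by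
  simpa using Matrix.posSemidef_conjTranspose_mul_self G

/-- The error covariance after the measurement update, in information form. -/
noncomputable def updatedCov (G : Matrix (Fin M) (Fin N) ℝ) (a : ℝ)
    (S : Matrix (Fin N) (Fin N) ℝ) : Matrix (Fin N) (Fin N) ℝ :=
  (a⁻¹ • (Gᵀ * G) + S⁻¹)⁻¹

theorem information_posDef (ha : 0 < a) (hS : S.PosDef) : (a⁻¹ • (Gᵀ * G) + S⁻¹).PosDef :=
  hS.inv.posSemidef_add ((posSemidef_transpose_mul_self G).smul (inv_nonneg.2 ha.le))

theorem updatedCov_posDef (ha : 0 < a) (hS : S.PosDef) : (updatedCov G a S).PosDef :=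
  (information_posDef ha hS).inv

theorem updatedCov_mul_information (ha : 0 < a) (hS : S.PosDef) :
    updatedCov G a S * (a⁻¹ • (Gᵀ * G) + S⁻¹) = 1 :=
  Matrix.nonsing_inv_mul _ ((Matrix.isUnit_iff_isUnit_det _).1 (information_posDef ha hS).isUnit)

/-- Push-through identity: `(a⁻¹ GᵀG + S⁻¹) S Gᵀ = a⁻¹ Gᵀ (G S Gᵀ + a I)`. An `M × M` inverse is
traded for an `N × N` one. -/
theorem kalmanGain_eq_updatedCov (ha : 0 < a) (hS : S.PosDef) :
    kalmanGain A G (a • 1) S = a⁻¹ • (A * updatedCov G a S * Gᵀ) := by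
  have hV := (Matrix.isUnit_iff_isUnit_det _).1
    (innovCov_posDef (G := G) (posDef_smul_one ha) hS.posSemidef).isUnit
  have hSS := Matrix.nonsing_inv_mul S ((Matrix.isUnit_iff_isUnit_det _).1 hS.isUnit)
  have h1 : (a⁻¹ • (Gᵀ * G) + S⁻¹) * (S * Gᵀ) = a⁻¹ • (Gᵀ * innovCov G (a • 1) S) := by
    rw [innovCov, Matrix.add_mul, ← Matrix.mul_assoc S⁻¹, hSS, Matrix.mul_add, smul_add,
      Matrix.mul_smul, smul_smul, inv_mul_cancel₀ ha.ne', one_smul, Matrix.mul_one, Matrix.one_mul,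
      Matrix.smul_mul]
    simp only [Matrix.mul_assoc]
  have h2 : S * Gᵀ = a⁻¹ • (updatedCov G a S * Gᵀ * innovCov G (a • 1) S) := by
    have := congrArg (fun X => updatedCov G a S * X) h1
    simp only [← Matrix.mul_assoc (updatedCov G a S) (a⁻¹ • (Gᵀ * G) + S⁻¹),
      updatedCov_mul_information ha hS, Matrix.one_mul, Matrix.mul_smul] at this
    rw [this, Matrix.mul_assoc (updatedCov G a S)]
  rw [kalmanGain, Matrix.mul_assoc A, h2, Matrix.mul_smul, Matrix.smul_mul,
    Matrix.mul_assoc A, Matrix.mul_assoc (_ * Gᵀ), Matrix.mul_nonsing_inv _ hV, Matrix.mul_one,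
    Matrix.mul_assoc A]

/-- The product form shows the smallness of `A - K G` that is hidden in the difference. -/
theorem closedLoop_eq_updatedCov (ha : 0 < a) (hS : S.PosDef) :
    A - kalmanGain A G (a • 1) S * G = A * updatedCov G a S * S⁻¹ := by
  have h := updatedCov_mul_information (G := G) ha hS
  rw [Matrix.mul_add] at h
  have h2 : updatedCov G a S * S⁻¹ = 1 - updatedCov G a S * a⁻¹ • (Gᵀ * G) := by
    rw [← h]; abel
  rw [kalmanGain_eq_updatedCov ha hS, Matrix.mul_assoc A _ S⁻¹, h2, Matrix.mul_sub, Matrix.mul_one,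
    Matrix.mul_smul, Matrix.mul_smul, Matrix.smul_mul]
  simp only [Matrix.mul_assoc]

theorem isUnit_of_rank_eq {A : Matrix (Fin N) (Fin N) ℝ} (hA : A.rank = N) : IsUnit A := by
  rw [← Matrix.linearIndependent_cols_iff_isUnit, linearIndependent_iff_card_eq_finrank_span,
    Fintype.card_fin, Set.finrank, ← Matrix.rank_eq_finrank_span_cols, hA]

theorem isUnit_gram (hG : G.rank = N) : IsUnit (Gᵀ * G) :=
  isUnit_of_rank_eq (by rw [Matrix.rank_transpose_mul_self, hG])

theorem gram_posDef (hG : G.rank = N) : (Gᵀ * G).PosDef := by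
  have := Matrix.PosDef.conjTranspose_mul_self G (by
    intro u v h
    have h2 := congrArg (fun z => Gᵀ *ᵥ z) h
    simp only [Matrix.mulVec_mulVec] at h2
    exact Matrix.mulVec_injective_of_isUnit (isUnit_gram hG) h2)
  simpa using this

/-- Multiplying `G K` on the left by `a Gᵀ` gives an invertible matrix times `Gᵀ`, so no rank below
`N` is possible. -/
theorem rank_mul_kalmanGain (ha : 0 < a) (hS : S.PosDef) (hA : A.rank = N) (hG : G.rank = N) :
    (G * kalmanGain A G (a • 1) S).rank = N := by
  refine le_antisymm ?_ ?_
  · exact (Matrix.rank_mul_le_left _ _).trans_eq hG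
  · have h1 : ((Gᵀ * G) * (A * updatedCov G a S) * Gᵀ).rank = N := by
      rw [Matrix.rank_mul_eq_right_of_isUnit_det, Matrix.rank_transpose, hG]
      exact (Matrix.isUnit_iff_isUnit_det _).1
        ((isUnit_gram hG).mul ((isUnit_of_rank_eq hA).mul (updatedCov_posDef ha hS).isUnit))
    have h2 : (Gᵀ * G) * (A * updatedCov G a S) * Gᵀ =
        (a • Gᵀ) * (G * kalmanGain A G (a • 1) S) := by
      rw [kalmanGain_eq_updatedCov ha hS, Matrix.mul_smul, Matrix.smul_mul, Matrix.mul_smul,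
        smul_smul, mul_inv_cancel₀ ha.ne', one_smul]
      simp only [Matrix.mul_assoc]
    rw [h2] at h1
    exact h1.symm.le.trans (Matrix.rank_mul_le_right _ _)

/-- Dropping the prior information `S⁻¹` can only enlarge the updated covariance. -/
theorem norm_updatedCov_le (ha : 0 < a) (hS : S.PosDef) (hG : G.rank = N) :
    ‖updatedCov G a S‖ ≤ N * (a * ‖(Gᵀ * G)⁻¹‖) := by
  refine (norm_inv_add_le ((gram_posDef hG).smul (inv_pos.2 ha)) hS.inv.posSemidef).trans_eq ?_
  have hdet := (Matrix.isUnit_iff_isUnit_det _).1 (isUnit_gram hG)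
  have : (a⁻¹ • (Gᵀ * G))⁻¹ = a • (Gᵀ * G)⁻¹ := by
    refine Matrix.inv_eq_left_inv ?_
    rw [Matrix.smul_mul, Matrix.mul_smul, smul_smul, mul_inv_cancel₀ ha.ne', one_smul,
      Matrix.nonsing_inv_mul _ hdet]
  rw [this, norm_smul, Real.norm_of_nonneg ha.le]

/-- The constant is free of `S` and `M`: the bound `S ≥ C Cᵀ` controls `S⁻¹`. -/
theorem norm_closedLoop_le (ha : 0 < a) (hS : S.PosSemidef) (hC : IsUnit C)
    (hRic : Riccati A C G (a • 1) S) (hG : G.rank = N) :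
    ‖A - kalmanGain A G (a • 1) S * G‖ ≤
      (‖A‖ * N * a * (N * ‖(C * Cᵀ)⁻¹‖)) * ‖(Gᵀ * G)⁻¹‖ := by
  have hR := posDef_smul_one (M := M) ha
  have hSd := hRic.posDef hR hC hS
  have h1 : ‖S⁻¹‖ ≤ N * ‖(C * Cᵀ)⁻¹‖ := by
    have := norm_inv_add_le (posDef_mul_transpose_of_isUnit hC) (hRic.sub_posSemidef hR hS)
    rwa [add_sub_cancel] at this
  rw [closedLoop_eq_updatedCov ha hSd]
  calc ‖A * updatedCov G a S * S⁻¹‖ ≤ ‖A‖ * ‖updatedCov G a S‖ * ‖S⁻¹‖ :=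
        (Matrix.frobenius_norm_mul _ _).trans (by gcongr; exact Matrix.frobenius_norm_mul _ _)
    _ ≤ ‖A‖ * (N * (a * ‖(Gᵀ * G)⁻¹‖)) * (N * ‖(C * Cᵀ)⁻¹‖) := by
        gcongr; exact norm_updatedCov_le ha hSd hG
    _ = _ := by ring

theorem norm_kalmanGain_le (ha : 0 < a) (hS : S.PosDef) (hG : G.rank = N) :
    ‖kalmanGain A G (a • 1) S‖ ≤ ‖A‖ * N * ‖(Gᵀ * G)⁻¹‖ * ‖G‖ := by
  rw [kalmanGain_eq_updatedCov ha hS, norm_smul, norm_inv, Real.norm_of_nonneg ha.le]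
  rw [inv_mul_le_iff₀ ha]
  calc ‖A * updatedCov G a S * Gᵀ‖ ≤ ‖A‖ * ‖updatedCov G a S‖ * ‖Gᵀ‖ :=
        (Matrix.frobenius_norm_mul _ _).trans (by gcongr; exact Matrix.frobenius_norm_mul _ _)
    _ ≤ ‖A‖ * (N * (a * ‖(Gᵀ * G)⁻¹‖)) * ‖G‖ := by
        rw [Matrix.frobenius_norm_transpose]
        gcongr; exact norm_updatedCov_le ha hS hG
    _ = _ := by ring

theorem norm_sq_le_gram (G : Matrix (Fin M) (Fin N) ℝ) : ‖G‖ ^ 2 ≤ N * ‖Gᵀ * G‖ := by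
  refine le_trans (le_of_eq ?_) (trace_le_card_mul_norm (Gᵀ * G))
  rw [frobenius_norm_sq, Finset.sum_comm]
  simp [Matrix.trace, Matrix.mul_apply, sq]

/-- The outer factors `G` and `K` together cost only `‖GᵀG‖ ‖(GᵀG)⁻¹‖`, which stays bounded in `M`;
all decay comes from the power of `A - K G`. -/
theorem norm_varCoeff_le (ha : 0 < a) (hS : S.PosSemidef) (hC : IsUnit C)
    (hRic : Riccati A C G (a • 1) S) (hG : G.rank = N) {j : ℕ} (hj : 2 ≤ j) :
    ‖varCoeff A G (a • 1) S j‖ ≤ (‖A‖ * N * N) * (‖Gᵀ * G‖ * ‖(Gᵀ * G)⁻¹‖) *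
      ‖A - kalmanGain A G (a • 1) S * G‖ ^ (j - 1) := by
  have hSd := hRic.posDef (posDef_smul_one ha) hC hS
  rw [varCoeff]
  set F := A - kalmanGain A G (a • 1) S * G
  calc ‖G * F ^ (j - 1) * kalmanGain A G (a • 1) S‖
      ≤ ‖G‖ * ‖F‖ ^ (j - 1) * (‖A‖ * N * ‖(Gᵀ * G)⁻¹‖ * ‖G‖) := by
        refine (Matrix.frobenius_norm_mul _ _).trans ?_
        gcongr
        · refine (Matrix.frobenius_norm_mul _ _).trans ?_
          gcongr
          -- The exponent must be positive, since the Frobenius norm of the identity is not `1` in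
          -- general; this uses `2 ≤ j`.
          exact norm_pow_le' F (by omega)
        · exact norm_kalmanGain_le ha hSd hG
    _ = ‖A‖ * N * ‖G‖ ^ 2 * ‖(Gᵀ * G)⁻¹‖ * ‖F‖ ^ (j - 1) := by ring
    _ ≤ ‖A‖ * N * (N * ‖Gᵀ * G‖) * ‖(Gᵀ * G)⁻¹‖ * ‖F‖ ^ (j - 1) := by
        gcongr; exact norm_sq_le_gram G
    _ = _ := by ring

end Gain

/-! ### Rates as `M → ∞` -/

section Asymptotic

variable {N : ℕ} {A C : Matrix (Fin N) (Fin N) ℝ} {G : (M : ℕ) → Matrix (Fin M) (Fin N) ℝ}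
  {a : ℝ} {S : ℕ → Matrix (Fin N) (Fin N) ℝ} (ha : 0 < a) (hS : ∀ M, (S M).PosSemidef)
  (hC : IsUnit C) (hRic : ∀ M, Riccati A C (G M) (a • 1) (S M))
  (hG : ∀ᶠ M in atTop, (G M).rank = N)
  (hG_upper : (fun M : ℕ => ‖(G M)ᵀ * G M‖) =O[atTop] fun M : ℕ => (M : ℝ))
  (hG_lower : (fun M : ℕ => ‖((G M)ᵀ * G M)⁻¹‖) =O[atTop] fun M : ℕ => (M : ℝ)⁻¹)

include ha hS hC hRic hG hG_lower in
theorem isBigO_closedLoop :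
    (fun M => ‖A - kalmanGain A (G M) (a • 1) (S M) * G M‖) =O[atTop] fun M : ℕ => (M : ℝ)⁻¹ := by
  refine IsBigO.trans (IsBigO.of_bound (‖A‖ * N * a * (N * ‖(C * Cᵀ)⁻¹‖)) ?_) hG_lower
  filter_upwards [hG] with M hM
  simpa using norm_closedLoop_le ha (hS M) hC (hRic M) hM

include ha hS hC hRic hG hG_upper hG_lower in
theorem isBigO_varCoeff {j : ℕ} (hj : 2 ≤ j) :
    (fun M => ‖varCoeff A (G M) (a • 1) (S M) j‖) =O[atTop]
      fun M : ℕ => ((M : ℝ)⁻¹) ^ (j - 1) := by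
  have h1 : (fun M : ℕ => ‖(G M)ᵀ * G M‖ * ‖((G M)ᵀ * G M)⁻¹‖) =O[atTop] fun _ => (1 : ℝ) := by
    refine (hG_upper.mul hG_lower).trans (IsBigO.of_bound 1 ?_)
    filter_upwards [eventually_gt_atTop 0] with M hM
    have : (M : ℝ) ≠ 0 := by positivity
    simp [this]
  have h2 := h1.mul ((isBigO_closedLoop ha hS hC hRic hG hG_lower).pow (j - 1))
  simp only [one_mul] at h2
  refine IsBigO.trans (IsBigO.of_bound (‖A‖ * N * N) ?_) h2
  filter_upwards [hG] with M hM
  have := norm_varCoeff_le ha (hS M) hC (hRic M) hM hj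
  rw [mul_assoc] at this
  simpa using this

include ha hS hC hRic hG hG_upper hG_lower in
theorem tendsto_varCoeff {j : ℕ} (hj : 2 ≤ j) :
    Tendsto (fun M => ‖varCoeff A (G M) (a • 1) (S M) j‖) atTop (𝓝 0) := by
  refine (isBigO_varCoeff ha hS hC hRic hG hG_upper hG_lower hj).trans_tendsto ?_
  have := (tendsto_inv_atTop_nhds_zero_nat (𝕜 := ℝ)).pow (j - 1)
  rwa [zero_pow (by omega)] at this

include ha hS hC hRic hG hG_upper hG_lower in
theorem limsup_varCoeff_lt_top {j : ℕ} (hj : 2 ≤ j) :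
    limsup (fun M : ℕ => (((M : ℝ) ^ (j - 1) * ‖varCoeff A (G M) (a • 1) (S M) j‖ : ℝ) : EReal))
      atTop < ⊤ := by
  obtain ⟨c, hc⟩ := (isBigO_varCoeff ha hS hC hRic hG hG_upper hG_lower hj).bound
  refine lt_of_le_of_lt (limsup_le_of_le (h := ?_)) (EReal.coe_lt_top c)
  filter_upwards [hc, eventually_gt_atTop 0] with M hM hM0
  rw [EReal.coe_le_coe_iff]
  have hpos : (0 : ℝ) < (M : ℝ) ^ (j - 1) := by positivity
  rw [norm_norm, inv_pow, norm_inv, Real.norm_of_nonneg hpos.le, ← div_eq_mul_inv,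
    le_div_iff₀ hpos] at hM
  linarith

include ha hS hC hRic hG hG_upper hG_lower in
theorem tendsto_norm_mul_norm_closedLoop :
    Tendsto (fun M => ‖G M‖ * ‖A - kalmanGain A (G M) (a • 1) (S M) * G M‖) atTop (𝓝 0) := by
  -- The product is squared to avoid half-integer powers of `M`: its square is `O(M · M⁻²)`.
  have h1 : (fun M => ‖G M‖ ^ 2) =O[atTop] fun M : ℕ => (M : ℝ) := by
    refine IsBigO.trans (IsBigO.of_bound N (Eventually.of_forall fun M => ?_)) hG_upper
    simpa using norm_sq_le_gram (G M)
  have h2 := h1.mul ((isBigO_closedLoop ha hS hC hRic hG hG_lower).pow 2)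
  have h3 : Tendsto (fun M : ℕ => (M : ℝ) * ((M : ℝ)⁻¹) ^ 2) atTop (𝓝 0) := by
    refine (tendsto_inv_atTop_nhds_zero_nat (𝕜 := ℝ)).congr fun M => ?_
    rcases eq_or_ne (M : ℝ) 0 with h | h
    · simp [h]
    · field_simp
  have h4 := (h2.trans_tendsto h3).sqrt
  rw [Real.sqrt_zero] at h4
  refine h4.congr fun M => ?_
  rw [← mul_pow, Real.sqrt_sq (by positivity)]

end Asymptotic


/-! ### Gaussian Hilbert spaces and conditional expectations -/

section GaussianSpace

variable {Ω : Type*} [MeasurableSpace Ω] {P : Measure Ω} [IsProbabilityMeasure P]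
  {ι : Type*} {W : ι → Ω → ℝ}

theorem tendsto_integral_of_tendsto_Lp {f : ℕ → Lp ℝ 2 P} {g : Lp ℝ 2 P}
    (h : Tendsto f atTop (𝓝 g)) :
    Tendsto (fun n => ∫ ω, f n ω ∂P) atTop (𝓝 (∫ ω, g ω ∂P)) := by
  refine tendsto_integral_of_L1' _ (Lp.aestronglyMeasurable g)
    (Eventually.of_forall fun n => (Lp.memLp (f n)).integrable (by norm_num)) ?_
  refine tendsto_of_tendsto_of_tendsto_of_le_of_le tendsto_const_nhds
    ((Lp.tendsto_Lp_iff_tendsto_eLpNorm' f g).1 h) (fun _ => zero_le) fun n => ?_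
  exact eLpNorm_le_eLpNorm_of_exponent_le (by norm_num)
    ((Lp.aestronglyMeasurable _).sub (Lp.aestronglyMeasurable _))

omit [IsProbabilityMeasure P] in
theorem integral_sq_coeFn_Lp (f : Lp ℝ 2 P) : ∫ ω, f ω ^ 2 ∂P = ‖f‖ ^ 2 := by
  rw [← real_inner_self_eq_norm_sq, L2.inner_def]
  simp [sq]

/-- Limits in `L²` of Gaussian random variables are Gaussian. -/
theorem hasGaussianLaw_of_tendsto_Lp {f : ℕ → Lp ℝ 2 P} {g : Lp ℝ 2 P}
    (hf : ∀ n, HasGaussianLaw (f n) P) (h : Tendsto f atTop (𝓝 g)) : HasGaussianLaw g P := by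
  have hmean := tendsto_integral_of_tendsto_Lp h
  have hvar_eq : ∀ k : Lp ℝ 2 P, Var[k; P] = ‖k‖ ^ 2 - (∫ ω, k ω ∂P) ^ 2 := fun k => by
    rw [variance_eq_sub (Lp.memLp k), ← integral_sq_coeFn_Lp]; rfl
  have hvar : Tendsto (fun n => Var[f n; P]) atTop (𝓝 Var[g; P]) := by
    simp_rw [hvar_eq]
    exact (h.norm.pow 2).sub (hmean.pow 2)
  have hE : ∀ (k : Lp ℝ 2 P) (t : ℝ), ∫ ω, inner ℝ t (k ω) ∂P = (∫ ω, k ω ∂P) * t := fun k t => by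
    simp [integral_mul_const]
  have hV : ∀ (k : Lp ℝ 2 P) (t : ℝ), Var[fun ω => inner ℝ t (k ω); P] = Var[k; P] * t ^ 2 :=
    fun k t => by
      simp only [Real.inner_apply, mul_comm]
      rw [variance_const_mul]
  refine (hasGaussianLaw_iff_charFun_map_eq (Lp.aestronglyMeasurable g).aemeasurable).2 fun t => ?_
  rw [hE, hV]
  -- Along an almost surely convergent subsequence the characteristic functions converge by
  -- dominated convergence; means and variances converge by `L²` convergence.
  obtain ⟨φ, hφ, hae⟩ := (tendstoInMeasure_of_tendsto_Lp h).exists_seq_tendsto_ae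
  have h1 : Tendsto (fun n => charFun (P.map (f (φ n))) t) atTop (𝓝 (charFun (P.map g) t)) := by
    have hcf : ∀ k : Lp ℝ 2 P, charFun (P.map k) t = ∫ ω, Complex.exp (t * k ω * Complex.I) ∂P :=
      fun k => by
        rw [charFun_apply_real, integral_map (Lp.aestronglyMeasurable k).aemeasurable]
        exact (by fun_prop : Continuous _).aestronglyMeasurable
    simp_rw [hcf]
    refine tendsto_integral_of_dominated_convergence (fun _ => 1) (fun n => ?_)
      (integrable_const _) (fun n => ?_) ?_
    · exact (by fun_prop : Continuous fun x : ℝ =>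
        Complex.exp (t * x * Complex.I)).comp_aestronglyMeasurable
          (Lp.aestronglyMeasurable (f (φ n)))
    · refine Eventually.of_forall fun ω => ?_
      rw [← Complex.ofReal_mul, Complex.norm_exp_ofReal_mul_I]
    · filter_upwards [hae] with ω hω
      exact ((by fun_prop : Continuous fun x : ℝ =>
        Complex.exp (t * x * Complex.I)).tendsto _).comp hω
  refine tendsto_nhds_unique h1 ?_
  have h2 : ∀ n, charFun (P.map (f (φ n))) t = Complex.exp
      (((∫ ω, f (φ n) ω ∂P) * t : ℝ) * Complex.I - (Var[f (φ n); P] * t ^ 2 : ℝ) / 2) := fun n => by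
    rw [(hf (φ n)).charFun_map_eq, hE, hV]
  simp_rw [h2]
  have hm' := (hmean.comp hφ.tendsto_atTop).mul_const t
  have hv' := (hvar.comp hφ.tendsto_atTop).mul_const (t ^ 2)
  exact ((((Complex.continuous_ofReal.tendsto _).comp hm').mul_const Complex.I).sub
    (((Complex.continuous_ofReal.tendsto _).comp hv').div_const 2)).cexp

/-- The span in `L²` of the random variables `W i`. -/
noncomputable def lpSpan (P : Measure Ω) (W : ι → Ω → ℝ) : Submodule ℝ (Lp ℝ 2 P) :=
  Submodule.span ℝ {f | ∃ i, f =ᵐ[P] W i}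

/-- The random variables in the closed linear span in `L²` of the random variables `W i`. -/
noncomputable def gaussSpace (P : Measure Ω) [IsProbabilityMeasure P] (W : ι → Ω → ℝ) :
    Submodule ℝ (Ω → ℝ) where
  carrier := {Z | ∃ f ∈ (lpSpan P W).topologicalClosure, f =ᵐ[P] Z}
  add_mem' := by
    rintro _ _ ⟨f, hf, hfZ⟩ ⟨g, hg, hgZ⟩
    exact ⟨f + g, add_mem hf hg, (Lp.coeFn_add f g).trans (hfZ.add hgZ)⟩
  zero_mem' := ⟨0, zero_mem _, Lp.coeFn_zero ℝ 2 P⟩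
  smul_mem' := by
    rintro c _ ⟨f, hf, hfZ⟩
    exact ⟨c • f, Submodule.smul_mem _ c hf, (Lp.coeFn_smul c f).trans (hfZ.const_smul c)⟩

theorem gaussSpace_congr {Z Z' : Ω → ℝ} (hZ : Z ∈ gaussSpace P W) (h : Z =ᵐ[P] Z') :
    Z' ∈ gaussSpace P W := by
  obtain ⟨f, hf, hfZ⟩ := hZ
  exact ⟨f, hf, hfZ.trans h⟩

theorem memLp_of_mem_gaussSpace {Z : Ω → ℝ} (hZ : Z ∈ gaussSpace P W) : MemLp Z 2 P := by
  obtain ⟨f, hf, hfZ⟩ := hZ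
  exact (memLp_congr_ae hfZ).1 (Lp.memLp f)

theorem base_mem_gaussSpace (hW : ∀ i, MemLp (W i) 2 P) (i : ι) : W i ∈ gaussSpace P W :=
  ⟨(hW i).toLp, Submodule.le_topologicalClosure _
    (Submodule.subset_span ⟨i, (hW i).coeFn_toLp⟩), (hW i).coeFn_toLp⟩

theorem mem_gaussSpace_of_tendsto {Z : ℕ → Ω → ℝ} {Y : Ω → ℝ} (hZ : ∀ n, Z n ∈ gaussSpace P W)
    (hY : MemLp Y 2 P) (h : Tendsto (fun n => eLpNorm (Z n - Y) 2 P) atTop (𝓝 0)) :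
    Y ∈ gaussSpace P W := by
  refine ⟨hY.toLp, ?_, hY.coeFn_toLp⟩
  refine (Submodule.isClosed_topologicalClosure (lpSpan P W)).mem_of_tendsto
    ((Lp.tendsto_Lp_iff_tendsto_eLpNorm'' Z (fun n => memLp_of_mem_gaussSpace (hZ n)) Y hY).2 h)
    (Eventually.of_forall fun n => ?_)
  obtain ⟨f, hf, hfZ⟩ := hZ n
  have : (memLp_of_mem_gaussSpace (hZ n)).toLp = f :=
    Lp.ext ((memLp_of_mem_gaussSpace (hZ n)).coeFn_toLp.trans hfZ.symm)
  rw [this]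
  exact hf

omit [IsProbabilityMeasure P] in
theorem exists_finsupp_of_mem_lpSpan {f : Lp ℝ 2 P} (hf : f ∈ lpSpan P W) :
    ∃ c : ι →₀ ℝ, f =ᵐ[P] fun ω => c.sum fun i a => a * W i ω := by
  induction hf using Submodule.span_induction with
  | mem f hf =>
    obtain ⟨i, hi⟩ := hf
    exact ⟨Finsupp.single i 1, by simpa using hi⟩
  | zero => exact ⟨0, by
    filter_upwards [Lp.coeFn_zero ℝ 2 P] with ω hω
    simpa using hω⟩
  | add f g _ _ hf hg =>
    obtain ⟨c, hc⟩ := hf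
    obtain ⟨d, hd⟩ := hg
    refine ⟨c + d, (Lp.coeFn_add f g).trans ((hc.add hd).trans (Eventually.of_forall fun ω => ?_))⟩
    classical
    exact (Finsupp.sum_add_index' (fun _ => zero_mul _) fun _ _ _ => add_mul _ _ _).symm
  | smul a f _ hf =>
    obtain ⟨c, hc⟩ := hf
    refine ⟨a • c, (Lp.coeFn_smul a f).trans
      ((hc.const_smul a).trans (Eventually.of_forall fun ω => ?_))⟩
    simp only [Pi.smul_apply, smul_eq_mul]
    rw [Finsupp.sum_smul_index (fun _ => zero_mul _), Finsupp.mul_sum]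
    simp only [mul_assoc]

theorem hasGaussianLaw_of_mem_gaussSpace (hW : IsGaussianProcess W P) {Z : Ω → ℝ}
    (hZ : Z ∈ gaussSpace P W) : HasGaussianLaw Z P := by
  obtain ⟨f, hf, hfZ⟩ := hZ
  refine HasGaussianLaw.congr ?_ hfZ
  obtain ⟨u, hu, hlim⟩ := mem_closure_iff_seq_limit.1 hf
  refine hasGaussianLaw_of_tendsto_Lp (fun n => ?_) hlim
  obtain ⟨c, hc⟩ := exists_finsupp_of_mem_lpSpan (hu n)
  refine HasGaussianLaw.congr ?_ hc.symm
  have := (hW.hasGaussianLaw c.support).map_fun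
    (∑ i : c.support, c i • (ContinuousLinearMap.proj i : (c.support → ℝ) →L[ℝ] ℝ))
  refine this.congr (Eventually.of_forall fun ω => ?_)
  simpa [Finsupp.sum] using Finset.sum_attach c.support (fun i => c i * W i ω)

theorem integral_eq_zero_of_mem_gaussSpace (hW : IsGaussianProcess W P)
    (hW0 : ∀ i, ∫ ω, W i ω ∂P = 0) {Z : Ω → ℝ}
    (hZ : Z ∈ gaussSpace P W) : ∫ ω, Z ω ∂P = 0 := by
  obtain ⟨f, hf, hfZ⟩ := hZ
  rw [← integral_congr_ae hfZ]
  obtain ⟨u, hu, hlim⟩ := mem_closure_iff_seq_limit.1 hf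
  refine tendsto_nhds_unique (tendsto_integral_of_tendsto_Lp hlim) ?_
  have h0 : ∀ n, ∫ ω, u n ω ∂P = 0 := fun n => by
    obtain ⟨c, hc⟩ := exists_finsupp_of_mem_lpSpan (hu n)
    rw [integral_congr_ae hc]
    simp only [Finsupp.sum]
    rw [integral_finsetSum _ fun i _ => (hW.hasGaussianLaw_eval i).integrable.const_mul _]
    simp [integral_const_mul, hW0]
  simp [h0]

/-- A linear functional of finitely many members is again a member, so joint Gaussianity reduces to
the one-dimensional case. -/
theorem isGaussianProcess_of_mem_gaussSpace (hW : IsGaussianProcess W P) {T : Type*}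
    {Z : T → Ω → ℝ} (hZ : ∀ t, Z t ∈ gaussSpace P W) : IsGaussianProcess Z P := by
  classical
  refine ⟨fun I => ⟨isGaussian_of_isGaussian_map fun L => ?_⟩⟩
  have hm : AEMeasurable (fun ω => I.restrict (Z · ω)) P :=
    aemeasurable_pi_iff.2 fun i => (memLp_of_mem_gaussSpace (hZ i)).aestronglyMeasurable.aemeasurable
  rw [AEMeasurable.map_map_of_aemeasurable (by fun_prop) hm]
  refine (hasGaussianLaw_of_mem_gaussSpace hW ?_).isGaussian_map
  have : L ∘ (fun ω => I.restrict (Z · ω)) = ∑ i : I, L (Pi.single i 1) • Z i := by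
    ext ω
    have h1 : I.restrict (Z · ω) = ∑ i : I, Z i ω • (Pi.single i (1 : ℝ) : I → ℝ) := by
      ext j
      simp [Finset.sum_apply, Pi.single_apply]
    simp only [Function.comp_apply]
    rw [h1, map_sum]
    simp [Finset.sum_apply, mul_comm]
  rw [this]
  exact Submodule.sum_mem _ fun i _ => Submodule.smul_mem _ _ (hZ i)

theorem past_le {m : ℕ} {y : ℤ → Ω → EuclideanSpace ℝ (Fin m)} (hy : ∀ s, Measurable (y s))
    (t : ℤ) : past y t ≤ ‹MeasurableSpace Ω› :=
  iSup_le fun s => (hy s).comap_le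

/-- In a Gaussian space, a centred random vector that is uncorrelated with the past has zero
conditional expectation given the past. -/
theorem condExp_past_eq_zero (hW : IsGaussianProcess W P) (hW0 : ∀ i, ∫ ω, W i ω ∂P = 0)
    {m n : ℕ} {y : ℤ → Ω → EuclideanSpace ℝ (Fin m)} {e : Ω → EuclideanSpace ℝ (Fin n)} {t : ℤ}
    (hym : ∀ s, Measurable (y s)) (hy : ∀ s i, (fun ω => y s ω i) ∈ gaussSpace P W)
    (he : ∀ i, (fun ω => e ω i) ∈ gaussSpace P W)
    (h : ∀ s < t, crossMoment P e (y s) = 0) : P[e | past y t] =ᵐ[P] 0 := by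
  have hem : AEMeasurable e P := by
    have : AEMeasurable (fun ω => (e ω).ofLp) P := aemeasurable_pi_iff.2 fun i =>
      (memLp_of_mem_gaussSpace (he i)).aestronglyMeasurable.aemeasurable
    exact (WithLp.measurable_toLp 2 (Fin n → ℝ)).comp_aemeasurable this
  -- The σ-algebra generated by `e` must be a sub-σ-algebra, so `e` is replaced by a measurable
  -- representative.
  wlog hmeas : Measurable e generalizing e
  · have hae := hem.ae_eq_mk
    refine (condExp_congr_ae hae).trans (this (e := hem.mk e) (fun i => ?_) (fun s hs => ?_)
      hem.measurable_mk.aemeasurable hem.measurable_mk)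
    · refine gaussSpace_congr (he i) ?_
      filter_upwards [hae] with ω hω
      rw [← hω]
    · rw [← h s hs]
      ext i k
      simp only [crossMoment, Matrix.of_apply]
      refine integral_congr_ae ?_
      filter_upwards [hae] with ω hω
      rw [← hω]
  -- Joint Gaussianity upgrades zero covariances to independence from the whole past at once,
  -- indexed by time and coordinate.
  have hI : IndepFun (fun ω i => e ω i) (fun ω (p : Set.Iio t × Fin m) => y p.1 ω p.2) P := by
    refine IsGaussianProcess.indepFun_of_covariance_eq_zero (X := fun i ω => e ω i)
      (Y := fun (p : Set.Iio t × Fin m) ω => y p.1 ω p.2)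
      (isGaussianProcess_of_mem_gaussSpace hW ?_) ?_ ?_ ?_
    · rintro (i | p)
      · exact he i
      · exact hy _ _
    · exact fun i => (memLp_of_mem_gaussSpace (he i)).aestronglyMeasurable.aemeasurable
    · exact fun p => (memLp_of_mem_gaussSpace (hy p.1 p.2)).aestronglyMeasurable.aemeasurable
    · intro i p
      rw [covariance_eq_sub (memLp_of_mem_gaussSpace (he i))
        (memLp_of_mem_gaussSpace (hy p.1 p.2)), integral_eq_zero_of_mem_gaussSpace hW hW0 (he i),
        zero_mul, sub_zero]
      exact congrFun (congrFun (h p.1 p.1.2) i) p.2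
  have hI2 : Indep (MeasurableSpace.comap e inferInstance) (past y t) P := by
    have h1 := (IndepFun_iff_Indep _ _ _).1 hI
    refine indep_of_indep_of_le_left (indep_of_indep_of_le_right h1 ?_) ?_
    · refine iSup_le fun s => ?_
      rw [← measurable_iff_comap_le]
      have hg : Measurable fun z : Set.Iio t × Fin m → ℝ =>
          WithLp.toLp 2 (fun i => z (s, i)) :=
        (WithLp.measurable_toLp 2 (Fin m → ℝ)).comp (by fun_prop)
      exact hg.comp (comap_measurable fun ω (p : Set.Iio t × Fin m) => y p.1 ω p.2)
    · rw [← measurable_iff_comap_le]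
      exact (WithLp.measurable_toLp 2 (Fin n → ℝ)).comp (comap_measurable fun ω i => e ω i)
  refine (condExp_indep_eq hmeas.comap_le (past_le hym t)
    (comap_measurable e).stronglyMeasurable hI2).trans (Eventually.of_forall fun ω => ?_)
  ext i
  simp only [Pi.zero_apply, PiLp.zero_apply]
  rw [eval_integral_piLp (fun i => (memLp_of_mem_gaussSpace (he i)).integrable (by norm_num))]
  exact integral_eq_zero_of_mem_gaussSpace hW hW0 (he i)

end GaussianSpace


/-! ### Cross moments and bounded linear recursions -/

section Moments

variable {Ω : Type*} [MeasurableSpace Ω] {P : Measure Ω} {k m n : ℕ}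
  {u u' : Ω → EuclideanSpace ℝ (Fin m)} {v v' : Ω → EuclideanSpace ℝ (Fin n)}

theorem memLp_toEuclideanLin (A : Matrix (Fin m) (Fin n) ℝ) (hv : MemLp v 2 P) :
    MemLp (fun ω => A.toEuclideanLin (v ω)) 2 P :=
  (LinearMap.toContinuousLinearMap A.toEuclideanLin).comp_memLp' hv

theorem eLpNorm_toEuclideanLin_le (A : Matrix (Fin m) (Fin n) ℝ)
    (v : Ω → EuclideanSpace ℝ (Fin n)) :
    eLpNorm (fun ω => A.toEuclideanLin (v ω)) 2 P ≤ ENNReal.ofReal ‖A‖ * eLpNorm v 2 P :=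
  eLpNorm_le_mul_eLpNorm_of_ae_le_mul
    (Eventually.of_forall fun ω => norm_toEuclideanLin_le A (v ω)) 2

theorem eLpNorm_coord_le (u : Ω → EuclideanSpace ℝ (Fin m)) (i : Fin m) :
    eLpNorm (fun ω => u ω i) 2 P ≤ eLpNorm u 2 P :=
  eLpNorm_mono fun ω => PiLp.norm_apply_le (u ω) i

theorem integrable_mul_coord (hu : MemLp u 2 P) (hv : MemLp v 2 P) (i : Fin m) (l : Fin n) :
    Integrable (fun ω => u ω i * v ω l) P :=
  (hu.eval_piLp i).integrable_mul (hv.eval_piLp l)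

theorem crossMoment_congr (hu : u =ᵐ[P] u') (hv : v =ᵐ[P] v') :
    crossMoment P u v = crossMoment P u' v' := by
  ext i l
  refine integral_congr_ae ?_
  filter_upwards [hu, hv] with ω h1 h2
  rw [h1, h2]

theorem crossMoment_transpose (u : Ω → EuclideanSpace ℝ (Fin m))
    (v : Ω → EuclideanSpace ℝ (Fin n)) : (crossMoment P u v)ᵀ = crossMoment P v u := by
  ext i l
  simp only [crossMoment, Matrix.transpose_apply, Matrix.of_apply, mul_comm]

theorem crossMoment_add_left (hu : MemLp u 2 P) (hu' : MemLp u' 2 P) (hv : MemLp v 2 P) :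
    crossMoment P (fun ω => u ω + u' ω) v = crossMoment P u v + crossMoment P u' v := by
  ext i l
  simp only [crossMoment, Matrix.of_apply, Matrix.add_apply, PiLp.add_apply, add_mul]
  exact integral_add (integrable_mul_coord hu hv i l) (integrable_mul_coord hu' hv i l)

theorem crossMoment_toEuclideanLin_left (A : Matrix (Fin k) (Fin m) ℝ) (hu : MemLp u 2 P)
    (hv : MemLp v 2 P) :
    crossMoment P (fun ω => A.toEuclideanLin (u ω)) v = A * crossMoment P u v := by
  ext i l
  simp only [crossMoment, Matrix.of_apply, Matrix.mul_apply, toEuclideanLin_apply_coord,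
    Finset.sum_mul, mul_assoc]
  rw [integral_finsetSum _ fun j _ => (integrable_mul_coord hu hv j l).const_mul _]
  simp only [integral_const_mul]

theorem crossMoment_add_right (hu : MemLp u 2 P) (hv : MemLp v 2 P) (hv' : MemLp v' 2 P) :
    crossMoment P u (fun ω => v ω + v' ω) = crossMoment P u v + crossMoment P u v' := by
  rw [← crossMoment_transpose, crossMoment_add_left hv hv' hu, Matrix.transpose_add,
    crossMoment_transpose, crossMoment_transpose]

theorem crossMoment_toEuclideanLin_right (A : Matrix (Fin k) (Fin n) ℝ) (hu : MemLp u 2 P)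
    (hv : MemLp v 2 P) :
    crossMoment P u (fun ω => A.toEuclideanLin (v ω)) = crossMoment P u v * Aᵀ := by
  rw [← crossMoment_transpose, crossMoment_toEuclideanLin_left A hv hu, Matrix.transpose_mul,
    crossMoment_transpose]

theorem crossMoment_lin_left {m₁ m₂ : ℕ} {u₁ : Ω → EuclideanSpace ℝ (Fin m₁)}
    {u₂ : Ω → EuclideanSpace ℝ (Fin m₂)} (B₁ : Matrix (Fin k) (Fin m₁) ℝ)
    (B₂ : Matrix (Fin k) (Fin m₂) ℝ) (h₁ : MemLp u₁ 2 P) (h₂ : MemLp u₂ 2 P) (hv : MemLp v 2 P) :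
    crossMoment P (fun ω => B₁.toEuclideanLin (u₁ ω) + B₂.toEuclideanLin (u₂ ω)) v =
      B₁ * crossMoment P u₁ v + B₂ * crossMoment P u₂ v := by
  rw [crossMoment_add_left (memLp_toEuclideanLin B₁ h₁) (memLp_toEuclideanLin B₂ h₂) hv,
    crossMoment_toEuclideanLin_left B₁ h₁ hv, crossMoment_toEuclideanLin_left B₂ h₂ hv]

theorem crossMoment_lin_right {n₁ n₂ : ℕ} {v₁ : Ω → EuclideanSpace ℝ (Fin n₁)}
    {v₂ : Ω → EuclideanSpace ℝ (Fin n₂)} (B₁ : Matrix (Fin k) (Fin n₁) ℝ)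
    (B₂ : Matrix (Fin k) (Fin n₂) ℝ) (hu : MemLp u 2 P) (h₁ : MemLp v₁ 2 P) (h₂ : MemLp v₂ 2 P) :
    crossMoment P u (fun ω => B₁.toEuclideanLin (v₁ ω) + B₂.toEuclideanLin (v₂ ω)) =
      crossMoment P u v₁ * B₁ᵀ + crossMoment P u v₂ * B₂ᵀ := by
  rw [← crossMoment_transpose, crossMoment_lin_left B₁ B₂ h₁ h₂ hu, Matrix.transpose_add,
    Matrix.transpose_mul, Matrix.transpose_mul, crossMoment_transpose, crossMoment_transpose]

theorem norm_crossMoment_le (hu : MemLp u 2 P) (hv : MemLp v 2 P) :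
    ‖crossMoment P u v‖ ≤ √(m * n) * ((eLpNorm u 2 P).toReal * (eLpNorm v 2 P).toReal) := by
  refine frobenius_norm_le_of_entry_le _ (by positivity) fun i l => ?_
  have hui := hu.eval_piLp i
  have hvl := hv.eval_piLp l
  have h1 : crossMoment P u v i l = inner ℝ (hvl.toLp) (hui.toLp) := by
    rw [L2.inner_def]
    refine integral_congr_ae ?_
    filter_upwards [hui.coeFn_toLp, hvl.coeFn_toLp] with ω h1 h2
    rw [h1, h2]
    simp
  rw [h1, mul_comm]
  refine (abs_real_inner_le_norm _ _).trans ?_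
  rw [Lp.norm_toLp, Lp.norm_toLp]
  gcongr
  · exact hv.2.ne
  · exact eLpNorm_coord_le v l
  · exact hu.2.ne
  · exact eLpNorm_coord_le u i

theorem crossMoment_self_posSemidef (hu : MemLp u 2 P) : (crossMoment P u u).PosSemidef := by
  refine posSemidef_iff_real.2 ⟨crossMoment_transpose u u, fun c => ?_⟩
  have : c ⬝ᵥ (crossMoment P u u *ᵥ c) = ∫ ω, (∑ i, c i * u ω i) ^ 2 ∂P := by
    simp only [sq, Finset.sum_mul_sum]
    rw [integral_finsetSum _ fun i _ => integrable_finsetSum _ fun j _ => by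
      simpa [mul_mul_mul_comm] using (integrable_mul_coord hu hu i j).const_mul (c i * c j)]
    simp only [dotProduct, Matrix.mulVec, Finset.mul_sum]
    refine Finset.sum_congr rfl fun i _ => ?_
    rw [integral_finsetSum _ fun j _ => by
      simpa [mul_mul_mul_comm] using (integrable_mul_coord hu hu i j).const_mul (c i * c j)]
    refine Finset.sum_congr rfl fun j _ => ?_
    simp only [mul_mul_mul_comm (c i) _ (c j)]
    rw [integral_const_mul]
    simp only [crossMoment, Matrix.of_apply]
    ring
  rw [this]
  exact integral_nonneg fun ω => sq_nonneg _

theorem crossMoment_eq_zero_of_indepFun (hu : MemLp u 2 P) (hv : MemLp v 2 P)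
    (hi : IndepFun u v P) (hu0 : ∀ i, ∫ ω, u ω i ∂P = 0) : crossMoment P u v = 0 := by
  ext i l
  have h := (hi.comp (φ := fun z : EuclideanSpace ℝ (Fin m) => z i)
    (ψ := fun z : EuclideanSpace ℝ (Fin n) => z l) (by fun_prop) (by fun_prop))
  have := h.integral_fun_mul_eq_mul_integral (hu.eval_piLp i).1 (hv.eval_piLp l).1
  simp only [Function.comp_apply] at this
  simp only [crossMoment, Matrix.of_apply, this, hu0, zero_mul, Matrix.zero_apply]

/-- A bounded two-sided solution of `D s = F D (s - 1) L` vanishes, if `F` is stable and the powers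
of `L` are bounded. -/
theorem eq_zero_of_bounded_recursion {D : ℤ → Matrix (Fin m) (Fin n) ℝ}
    {F : Matrix (Fin m) (Fin m) ℝ} {L : Matrix (Fin n) (Fin n) ℝ} {t : ℤ} {b l : ℝ}
    (hF : Tendsto (fun k : ℕ => ‖F ^ k‖) atTop (𝓝 0)) (hL : ∀ k : ℕ, ‖L ^ k‖ ≤ l)
    (hb : ∀ s, ‖D s‖ ≤ b) (hD : ∀ s ≤ t, D s = F * D (s - 1) * L) : D t = 0 := by
  -- The recursion is unrolled into the infinite past, where boundedness replaces an initial
  -- condition.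
  have hk : ∀ k : ℕ, D t = F ^ k * D (t - k) * L ^ k := by
    intro k
    induction k with
    | zero => simp
    | succ k ih =>
      rw [ih, hD (t - k) (by omega), pow_succ, pow_succ']
      push_cast
      rw [← sub_sub]
      simp only [Matrix.mul_assoc]
  have hb0 : 0 ≤ b := (norm_nonneg _).trans (hb t)
  have hle : ∀ k : ℕ, ‖D t‖ ≤ ‖F ^ k‖ * b * l := fun k => by
    calc ‖D t‖ = ‖F ^ k * D (t - k) * L ^ k‖ := by rw [← hk k]
      _ ≤ ‖F ^ k‖ * ‖D (t - k)‖ * ‖L ^ k‖ := (Matrix.frobenius_norm_mul _ _).trans (by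
          gcongr; exact Matrix.frobenius_norm_mul _ _)
      _ ≤ ‖F ^ k‖ * b * l := by gcongr; exacts [hb _, hL k]
  have hlim : Tendsto (fun k : ℕ => ‖F ^ k‖ * b * l) atTop (𝓝 0) := by
    simpa using (hF.mul_const b).mul_const l
  exact norm_le_zero_iff.1 (ge_of_tendsto' hlim hle)

end Moments

/-! ### Stable autoregressions in `L²` -/

section Autoregression

variable {Ω : Type*} [MeasurableSpace Ω] {P : Measure Ω} {k m n : ℕ}
  {z u : ℤ → Ω → EuclideanSpace ℝ (Fin n)} {F : Matrix (Fin n) (Fin n) ℝ}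

theorem autoregression_iterate
    (hz : ∀ t, ∀ᵐ ω ∂P, z (t + 1) ω = F.toEuclideanLin (z t ω) + u (t + 1) ω) (t : ℤ) (k : ℕ) :
    ∀ᵐ ω ∂P, z t ω = (F ^ k).toEuclideanLin (z (t - k) ω) +
      ∑ i ∈ Finset.range k, (F ^ i).toEuclideanLin (u (t - i) ω) := by
  induction k with
  | zero => simp
  | succ k ih =>
    have h := hz (t - k - 1)
    rw [sub_add_cancel] at h
    filter_upwards [ih, h] with ω h1 h2
    rw [h1, h2, map_add, ← toEuclideanLin_mul_apply, ← pow_succ, Finset.sum_range_succ]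
    push_cast
    rw [← sub_sub]
    abel

/-- After `k` steps back the old state contributes at most `c / 2`, which is absorbed on the left
because `c` is finite. The resulting bound depends on `F` and the shocks only. -/
theorem eLpNorm_autoregression_le {c : ENNReal} {k : ℕ} (hc : c ≠ ⊤) (hzc : ∀ t, eLpNorm (z t) 2 P = c)
    (hzm : ∀ t, AEStronglyMeasurable (z t) P) (hum : ∀ t, MemLp (u t) 2 P) {d : ENNReal}
    (hud : ∀ t, eLpNorm (u t) 2 P ≤ d) (hk : ‖F ^ k‖ ≤ 1 / 2)
    (hz : ∀ t, ∀ᵐ ω ∂P, z (t + 1) ω = F.toEuclideanLin (z t ω) + u (t + 1) ω) :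
    c ≤ 2 * (∑ i ∈ Finset.range k, ENNReal.ofReal ‖F ^ i‖ * d) := by
  have hz2 : ∀ t, MemLp (z t) 2 P := fun t => ⟨hzm t, by rw [hzc]; exact hc.lt_top⟩
  have h1 : c ≤ ENNReal.ofReal (1 / 2) * c + ∑ i ∈ Finset.range k, ENNReal.ofReal ‖F ^ i‖ * d := by
    calc c = eLpNorm (z 0) 2 P := (hzc 0).symm
      _ = eLpNorm ((fun ω => (F ^ k).toEuclideanLin (z (0 - k) ω)) +
          ∑ i ∈ Finset.range k, fun ω => (F ^ i).toEuclideanLin (u (0 - i) ω)) 2 P := by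
          refine eLpNorm_congr_ae ?_
          filter_upwards [autoregression_iterate hz 0 k] with ω hω
          rw [hω]
          simp [Finset.sum_apply]
      _ ≤ eLpNorm (fun ω => (F ^ k).toEuclideanLin (z (0 - k) ω)) 2 P +
          eLpNorm (∑ i ∈ Finset.range k, fun ω => (F ^ i).toEuclideanLin (u (0 - i) ω)) 2 P :=
          eLpNorm_add_le (memLp_toEuclideanLin _ (hz2 _)).1
            (Finset.aestronglyMeasurable_sum _ fun i _ => (memLp_toEuclideanLin _ (hum _)).1)
            (by norm_num)
      _ ≤ _ := by
          gcongr
          · refine (eLpNorm_toEuclideanLin_le _ _).trans ?_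
            rw [hzc]
            gcongr
          · refine (eLpNorm_sum_le (fun i _ => (memLp_toEuclideanLin _ (hum _)).1)
              (by norm_num)).trans (Finset.sum_le_sum fun i _ => ?_)
            refine (eLpNorm_toEuclideanLin_le _ _).trans ?_
            gcongr
            exact hud _
  set s := ∑ i ∈ Finset.range k, ENNReal.ofReal ‖F ^ i‖ * d
  have h2 : ENNReal.ofReal (1 / 2) = 2⁻¹ := by
    rw [one_div, ENNReal.ofReal_inv_of_pos (by norm_num)]; simp
  rw [h2] at h1
  have hhalf : c = 2⁻¹ * c + 2⁻¹ * c := by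
    rw [← add_mul, ENNReal.inv_two_add_inv_two, one_mul]
  have hne : 2⁻¹ * c ≠ ⊤ := ENNReal.mul_ne_top (by simp) hc
  have h3 : 2⁻¹ * c ≤ s := by
    exact (ENNReal.add_le_add_iff_left hne).1 (hhalf.symm.trans_le h1)
  calc c = 2 * (2⁻¹ * c) := by
        rw [← mul_assoc, ENNReal.mul_inv_cancel (by norm_num) (by norm_num), one_mul]
    _ ≤ 2 * s := by gcongr

/-- All coordinates of the random vector `u` lie in the closed linear span of the `W i`. -/
def InGaussSpace {Ω : Type*} [MeasurableSpace Ω] (P : Measure Ω) [IsProbabilityMeasure P]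
    {ι : Type*} (W : ι → Ω → ℝ) {n : ℕ} (u : Ω → EuclideanSpace ℝ (Fin n)) : Prop :=
  ∀ i, (fun ω => u ω i) ∈ gaussSpace P W

variable [IsProbabilityMeasure P] {ι : Type*} {W : ι → Ω → ℝ}
  {a b : Ω → EuclideanSpace ℝ (Fin n)}

theorem InGaussSpace.add (ha : InGaussSpace P W a) (hb : InGaussSpace P W b) :
    InGaussSpace P W (fun ω => a ω + b ω) :=
  fun i => add_mem (ha i) (hb i)

theorem InGaussSpace.congr (ha : InGaussSpace P W a) (h : a =ᵐ[P] b) : InGaussSpace P W b :=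
  fun i => gaussSpace_congr (ha i) (by filter_upwards [h] with ω hω; rw [hω])

theorem InGaussSpace.toEuclideanLin (ha : InGaussSpace P W a) (A : Matrix (Fin m) (Fin n) ℝ) :
    InGaussSpace P W (fun ω => A.toEuclideanLin (a ω)) := by
  intro i
  have : (fun ω => A.toEuclideanLin (a ω) i) = ∑ j, A i j • fun ω => a ω j := by
    ext ω
    simp [toEuclideanLin_apply_coord, Finset.sum_apply]
  rw [this]
  exact Submodule.sum_mem _ fun j _ => Submodule.smul_mem _ _ (ha j)

theorem InGaussSpace.sum {κ : Type*} {s : Finset κ} {f : κ → Ω → EuclideanSpace ℝ (Fin n)}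
    (hf : ∀ j ∈ s, InGaussSpace P W (f j)) : InGaussSpace P W (fun ω => ∑ j ∈ s, f j ω) := by
  intro i
  have : (fun ω => (∑ j ∈ s, f j ω) i) = ∑ j ∈ s, fun ω => f j ω i := by
    ext ω
    simp [Finset.sum_apply]
  rw [this]
  exact Submodule.sum_mem _ fun j hj => hf j hj i

/-- A bounded solution of a stable autoregression lies in the Gaussian space of its shocks. -/
theorem inGaussSpace_autoregression {c : ENNReal} (hc : c ≠ ⊤) (hzc : ∀ t, eLpNorm (z t) 2 P ≤ c)
    (hz2 : ∀ t, MemLp (z t) 2 P) (hu : ∀ t, InGaussSpace P W (u t))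
    (hF : Tendsto (fun k : ℕ => ‖F ^ k‖) atTop (𝓝 0))
    (hz : ∀ t, ∀ᵐ ω ∂P, z (t + 1) ω = F.toEuclideanLin (z t ω) + u (t + 1) ω) (t : ℤ) :
    InGaussSpace P W (z t) := by
  intro i
  refine mem_gaussSpace_of_tendsto
    (Z := fun k ω => (∑ l ∈ Finset.range k, (F ^ l).toEuclideanLin (u (t - l) ω)) i)
    (fun k => InGaussSpace.sum (fun l _ => (hu _).toEuclideanLin _) i) ((hz2 t).eval_piLp i) ?_
  have hlim : Tendsto (fun k : ℕ => ENNReal.ofReal ‖F ^ k‖ * c) atTop (𝓝 0) := by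
    have := ENNReal.Tendsto.mul_const (b := c) (ENNReal.tendsto_ofReal hF) (Or.inr hc)
    simpa using this
  refine tendsto_of_tendsto_of_tendsto_of_le_of_le tendsto_const_nhds hlim (fun _ => zero_le)
    fun k => ?_
  calc _ ≤ eLpNorm (fun ω => (F ^ k).toEuclideanLin (z (t - k) ω)) 2 P := by
        refine eLpNorm_mono_ae ?_
        filter_upwards [autoregression_iterate hz t k] with ω hω
        refine le_trans (le_of_eq ?_) (PiLp.norm_apply_le _ i)
        rw [Pi.sub_apply, hω, PiLp.add_apply, sub_add_cancel_right, norm_neg]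
    _ ≤ ENNReal.ofReal ‖F ^ k‖ * eLpNorm (z (t - k)) 2 P := eLpNorm_toEuclideanLin_le _ _
    _ ≤ _ := by gcongr; exact hzc _

end Autoregression


/-! ### Moments of Gaussian noise -/

section Noise

variable {Ω : Type*} [MeasurableSpace Ω] {P : Measure Ω} [IsProbabilityMeasure P] {n : ℕ}
  {u : Ω → EuclideanSpace ℝ (Fin n)} {V : Matrix (Fin n) (Fin n) ℝ}

omit [IsProbabilityMeasure P] in
theorem memLp_of_hasLaw_gaussian (hu : HasLaw u (multivariateGaussian 0 V) P) : MemLp u 2 P :=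
  hu.hasGaussianLaw.memLp_two

omit [IsProbabilityMeasure P] in
theorem integral_coord_of_hasLaw_gaussian (hu : HasLaw u (multivariateGaussian 0 V) P)
    (i : Fin n) : ∫ ω, u ω i ∂P = 0 := by
  have := hu.hasGaussianLaw.isProbabilityMeasure
  rw [← eval_integral_piLp
    (fun i => (((memLp_of_hasLaw_gaussian hu).eval_piLp i).integrable (by norm_num))) i]
  have := hu.integral_eq
  simp [this]

theorem crossMoment_of_hasLaw_gaussian (hV : V.PosSemidef)
    (hu : HasLaw u (multivariateGaussian 0 V) P) : crossMoment P u u = V := by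
  ext i j
  have hm := memLp_of_hasLaw_gaussian hu
  have h1 := hu.covariance_fun_comp (f := fun z => z i) (g := fun z => z j)
    (by fun_prop) (by fun_prop)
  rw [covariance_eval_multivariateGaussian hV,
    covariance_eq_sub (hm.eval_piLp i) (hm.eval_piLp j),
    integral_coord_of_hasLaw_gaussian hu, zero_mul, sub_zero] at h1
  exact h1

omit [IsProbabilityMeasure P] in
theorem eLpNorm_of_hasLaw (hu : HasLaw u (multivariateGaussian 0 V) P) :
    eLpNorm u 2 P = eLpNorm id 2 (multivariateGaussian 0 V) := by
  rw [← hu.map_eq, eLpNorm_map_measure aestronglyMeasurable_id hu.aemeasurable]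
  rfl

end Noise

/-! ### The factor model: Gaussianity and second moments -/

section Model

variable {Ω : Type*} [MeasurableSpace Ω] {P : Measure Ω} [IsProbabilityMeasure P] {N M : ℕ}
  {A C : Matrix (Fin N) (Fin N) ℝ} {G : Matrix (Fin M) (Fin N) ℝ} {R : Matrix (Fin M) (Fin M) ℝ}
  {x w : ℤ → Ω → EuclideanSpace ℝ (Fin N)} {y v : ℤ → Ω → EuclideanSpace ℝ (Fin M)}

/-- The coordinates of the two noises, as one family of real random variables. -/
def noise (w : ℤ → Ω → EuclideanSpace ℝ (Fin N)) (v : ℤ → Ω → EuclideanSpace ℝ (Fin M)) :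
    (ℤ × Fin N) ⊕ (ℤ × Fin M) → Ω → ℝ :=
  Sum.elim (fun p ω => w p.1 ω p.2) (fun p ω => v p.1 ω p.2)

variable (h : IsGaussianDFM P A C G R x w y v)
include h

namespace IsGaussianDFM

omit [IsProbabilityMeasure P] in
theorem memLp_w (t : ℤ) : MemLp (w t) 2 P := memLp_of_hasLaw_gaussian (h.law_w t)

omit [IsProbabilityMeasure P] in
theorem memLp_v (t : ℤ) : MemLp (v t) 2 P := memLp_of_hasLaw_gaussian (h.law_v t)

omit [IsProbabilityMeasure P] in
theorem memLp_y (t : ℤ) : MemLp (y t) 2 P :=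
  (memLp_congr_ae (h.obs_eq t)).2 ((memLp_toEuclideanLin G (h.memLp_x t)).add (h.memLp_v t))

omit [IsProbabilityMeasure P] in
theorem isGaussianProcess_noise : IsGaussianProcess (noise w v) P := by
  classical
  refine ⟨fun I => ?_⟩
  -- With `J` the times occurring in `I`, the marginal on `I` is a linear image of the noise vectors
  -- at times in `J`, which are independent and Gaussian.
  set J : Finset ℤ := I.image (Sum.elim Prod.fst Prod.fst) with hJ
  have hJm : ∀ i ∈ I, Sum.elim Prod.fst Prod.fst i ∈ J := fun i hi =>
    Finset.mem_image_of_mem _ hi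
  have hX : HasGaussianLaw (fun ω (t : J) => w t ω) P :=
    iIndepFun.hasGaussianLaw (fun t : J => (h.law_w t).hasGaussianLaw)
      (h.indep_w.precomp Subtype.val_injective)
  have hY : HasGaussianLaw (fun ω (t : J) => v t ω) P :=
    iIndepFun.hasGaussianLaw (fun t : J => (h.law_v t).hasGaussianLaw)
      (h.indep_v.precomp Subtype.val_injective)
  have hXY : IndepFun (fun ω (t : J) => w t ω) (fun ω (t : J) => v t ω) P :=
    h.indep_w_v.comp (φ := fun (z : ℤ → EuclideanSpace ℝ (Fin N)) (t : J) => z t)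
      (ψ := fun (z : ℤ → EuclideanSpace ℝ (Fin M)) (t : J) => z t) (by fun_prop) (by fun_prop)
  have hjoint := IndepFun.hasGaussianLaw hX hY hXY
  let L : I → ((J → EuclideanSpace ℝ (Fin N)) × (J → EuclideanSpace ℝ (Fin M))) →L[ℝ] ℝ :=
    fun i => match i with
    | ⟨Sum.inl p, hp⟩ => (EuclideanSpace.proj p.2 : EuclideanSpace ℝ (Fin N) →L[ℝ] ℝ).comp
        ((ContinuousLinearMap.proj (⟨p.1, hJm _ hp⟩ : J)).comp (ContinuousLinearMap.fst ℝ _ _))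
    | ⟨Sum.inr p, hp⟩ => (EuclideanSpace.proj p.2 : EuclideanSpace ℝ (Fin M) →L[ℝ] ℝ).comp
        ((ContinuousLinearMap.proj (⟨p.1, hJm _ hp⟩ : J)).comp (ContinuousLinearMap.snd ℝ _ _))
  refine (hjoint.map_fun (ContinuousLinearMap.pi L)).congr (Eventually.of_forall fun ω => ?_)
  ext ⟨i, hi⟩
  rcases i with p | p <;> rfl

omit [IsProbabilityMeasure P] in
theorem integral_noise (i : (ℤ × Fin N) ⊕ (ℤ × Fin M)) : ∫ ω, noise w v i ω ∂P = 0 := by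
  rcases i with p | p
  · exact integral_coord_of_hasLaw_gaussian (h.law_w p.1) p.2
  · exact integral_coord_of_hasLaw_gaussian (h.law_v p.1) p.2

omit [IsProbabilityMeasure P] in
theorem memLp_noise (i : (ℤ × Fin N) ⊕ (ℤ × Fin M)) : MemLp (noise w v i) 2 P := by
  rcases i with p | p
  · exact (h.memLp_w p.1).eval_piLp p.2
  · exact (h.memLp_v p.1).eval_piLp p.2

theorem inGaussSpace_w (t : ℤ) : InGaussSpace P (noise w v) (w t) :=
  fun i => base_mem_gaussSpace h.memLp_noise (Sum.inl (t, i))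

theorem inGaussSpace_v (t : ℤ) : InGaussSpace P (noise w v) (v t) :=
  fun i => base_mem_gaussSpace h.memLp_noise (Sum.inr (t, i))

theorem crossMoment_w_self (t : ℤ) : crossMoment P (w t) (w t) = 1 :=
  crossMoment_of_hasLaw_gaussian Matrix.PosSemidef.one (h.law_w t)

theorem crossMoment_v_self (hR : R.PosSemidef) (t : ℤ) : crossMoment P (v t) (v t) = R :=
  crossMoment_of_hasLaw_gaussian hR (h.law_v t)

omit [IsProbabilityMeasure P] in
theorem crossMoment_w_w {s t : ℤ} (hst : s ≠ t) : crossMoment P (w s) (w t) = 0 :=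
  crossMoment_eq_zero_of_indepFun (h.memLp_w s) (h.memLp_w t) (h.indep_w.indepFun hst)
    (integral_coord_of_hasLaw_gaussian (h.law_w s))

omit [IsProbabilityMeasure P] in
theorem crossMoment_v_v {s t : ℤ} (hst : s ≠ t) : crossMoment P (v s) (v t) = 0 :=
  crossMoment_eq_zero_of_indepFun (h.memLp_v s) (h.memLp_v t) (h.indep_v.indepFun hst)
    (integral_coord_of_hasLaw_gaussian (h.law_v s))

omit [IsProbabilityMeasure P] in
theorem crossMoment_w_v (s t : ℤ) : crossMoment P (w s) (v t) = 0 :=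
  crossMoment_eq_zero_of_indepFun (h.memLp_w s) (h.memLp_v t)
    (h.indep_w_v.comp (measurable_pi_apply s) (measurable_pi_apply t))
    (integral_coord_of_hasLaw_gaussian (h.law_w s))

omit [IsProbabilityMeasure P] in
theorem crossMoment_v_w (s t : ℤ) : crossMoment P (v s) (w t) = 0 := by
  rw [← crossMoment_transpose, h.crossMoment_w_v, Matrix.transpose_zero]

omit [IsProbabilityMeasure P] in
theorem eLpNorm_x (s t : ℤ) : eLpNorm (x s) 2 P = eLpNorm (x t) 2 P :=
  (h.stationary_x s t).eLpNorm_eq 2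

omit [IsProbabilityMeasure P] in
theorem state_eq' (t : ℤ) :
    x t =ᵐ[P] fun ω => A.toEuclideanLin (x (t - 1) ω) + C.toEuclideanLin (w t ω) := by
  have := h.state_eq (t - 1)
  rwa [sub_add_cancel] at this

omit [IsProbabilityMeasure P] in
theorem exists_eLpNorm_y_le : ∃ c : ENNReal, c ≠ ⊤ ∧ ∀ t, eLpNorm (y t) 2 P ≤ c := by
  refine ⟨ENNReal.ofReal ‖G‖ * eLpNorm (x 0) 2 P + eLpNorm (v 0) 2 P,
    ENNReal.add_ne_top.2 ⟨ENNReal.mul_ne_top ENNReal.ofReal_ne_top (h.memLp_x 0).2.ne,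
      (h.memLp_v 0).2.ne⟩, fun t => ?_⟩
  calc eLpNorm (y t) 2 P
      = eLpNorm ((fun ω => G.toEuclideanLin (x t ω)) + v t) 2 P := eLpNorm_congr_ae (h.obs_eq t)
    _ ≤ _ := (eLpNorm_add_le (memLp_toEuclideanLin G (h.memLp_x t)).1 (h.memLp_v t).1
          (by norm_num))
    _ ≤ _ := by
        rw [h.eLpNorm_x 0 t, eLpNorm_of_hasLaw (h.law_v 0), eLpNorm_of_hasLaw (h.law_v t)]
        gcongr
        exact eLpNorm_toEuclideanLin_le _ _

omit [IsProbabilityMeasure P] in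
/-- The second moment of the state is bounded in terms of `A`, `C` and the dimension only. -/
theorem eLpNorm_x_le {k : ℕ} (hk : ‖A ^ k‖ ≤ 1 / 2) (t : ℤ) :
    eLpNorm (x t) 2 P ≤ 2 * ∑ i ∈ Finset.range k, ENNReal.ofReal ‖A ^ i‖ *
      (ENNReal.ofReal ‖C‖ * eLpNorm id 2 (multivariateGaussian 0 (1 : Matrix (Fin N) (Fin N) ℝ))) := by
  refine eLpNorm_autoregression_le (u := fun t ω => C.toEuclideanLin (w t ω)) (h.memLp_x t).2.ne
    (fun s => h.eLpNorm_x s t) (fun s => (h.memLp_x s).1)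
    (fun s => memLp_toEuclideanLin C (h.memLp_w s)) (fun s => ?_) hk h.state_eq
  rw [← eLpNorm_of_hasLaw (h.law_w s)]
  exact eLpNorm_toEuclideanLin_le _ _

variable (hA : Tendsto (fun k : ℕ => ‖A ^ k‖) atTop (𝓝 0))
include hA

theorem inGaussSpace_x (t : ℤ) : InGaussSpace P (noise w v) (x t) :=
  inGaussSpace_autoregression (u := fun t ω => C.toEuclideanLin (w t ω)) (h.memLp_x 0).2.ne
    (fun s => (h.eLpNorm_x s 0).le) h.memLp_x (fun s => (h.inGaussSpace_w s).toEuclideanLin C) hA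
    h.state_eq t

theorem inGaussSpace_y (t : ℤ) : InGaussSpace P (noise w v) (y t) :=
  (((h.inGaussSpace_x hA t).toEuclideanLin G).add (h.inGaussSpace_v t)).congr
    (EventuallyEq.symm (h.obs_eq t))

omit [IsProbabilityMeasure P] in
-- For `r ≤ s < t` the shock `w_r` is uncorrelated with `w_t`, so the cross moment obeys a
-- homogeneous stable recursion and vanishes.
theorem crossMoment_x_w {s t : ℤ} (hst : s < t) : crossMoment P (x s) (w t) = 0 := by
  refine eq_zero_of_bounded_recursion (D := fun s => crossMoment P (x s) (w t)) (L := 1)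
    (l := ‖(1 : Matrix (Fin N) (Fin N) ℝ)‖) hA (fun k => by rw [one_pow])
    (b := √(N * N) * ((eLpNorm (x 0) 2 P).toReal * (eLpNorm (w t) 2 P).toReal))
    (fun r => h.eLpNorm_x 0 r ▸ norm_crossMoment_le (h.memLp_x r) (h.memLp_w t)) fun r hr => ?_
  rw [crossMoment_congr (h.state_eq' r) (ae_eq_refl _),
    crossMoment_lin_left A C (h.memLp_x _) (h.memLp_w _) (h.memLp_w t),
    h.crossMoment_w_w (by omega)]
  simp

omit [IsProbabilityMeasure P] in
theorem crossMoment_x_v (s t : ℤ) : crossMoment P (x s) (v t) = 0 := by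
  refine eq_zero_of_bounded_recursion (D := fun s => crossMoment P (x s) (v t)) (L := 1)
    (l := ‖(1 : Matrix (Fin M) (Fin M) ℝ)‖) hA (fun k => by rw [one_pow])
    (b := √(N * M) * ((eLpNorm (x 0) 2 P).toReal * (eLpNorm (v t) 2 P).toReal))
    (fun r => h.eLpNorm_x 0 r ▸ norm_crossMoment_le (h.memLp_x r) (h.memLp_v t)) fun r hr => ?_
  rw [crossMoment_congr (h.state_eq' r) (ae_eq_refl _),
    crossMoment_lin_left A C (h.memLp_x _) (h.memLp_w _) (h.memLp_v t),
    h.crossMoment_w_v]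
  simp

/-- The stationary covariance of the state solves the Lyapunov equation. -/
theorem crossMoment_x_self (t : ℤ) :
    crossMoment P (x t) (x t) = A * crossMoment P (x t) (x t) * Aᵀ + C * Cᵀ := by
  have hstat : crossMoment P (x t) (x t) = crossMoment P (x (t - 1)) (x (t - 1)) := by
    ext i j
    exact ((h.stationary_x t (t - 1)).comp
      (u := fun z : EuclideanSpace ℝ (Fin N) => z i * z j) (by fun_prop)).integral_eq
  have hxw := h.crossMoment_x_w hA (sub_one_lt t)
  have hwx : crossMoment P (w t) (x (t - 1)) = 0 := by
    rw [← crossMoment_transpose, hxw, Matrix.transpose_zero]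
  conv_lhs => rw [crossMoment_congr (h.state_eq' t) (h.state_eq' t)]
  rw [crossMoment_lin_left A C (h.memLp_x _) (h.memLp_w _)
      ((memLp_congr_ae (h.state_eq' t)).1 (h.memLp_x t)),
    crossMoment_lin_right A C (h.memLp_x _) (h.memLp_x _) (h.memLp_w _),
    crossMoment_lin_right A C (h.memLp_w _) (h.memLp_x _) (h.memLp_w _),
    hxw, hwx, h.crossMoment_w_self, ← hstat]
  simp [Matrix.mul_assoc]

end IsGaussianDFM

end Model


/-! ### The observer as an almost surely convergent series -/

section Observer

variable {Ω : Type*} [MeasurableSpace Ω] {P : Measure Ω} {N M : ℕ}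
  {F : Matrix (Fin N) (Fin N) ℝ} {K : Matrix (Fin N) (Fin M) ℝ}
  {y : ℤ → Ω → EuclideanSpace ℝ (Fin M)}

/-- The stationary solution `∑ⱼ F^j K y_{t-1-j}` of the observer equation
`z_{t+1} = F z_t + K y_t`. -/
noncomputable def observer (F : Matrix (Fin N) (Fin N) ℝ) (K : Matrix (Fin N) (Fin M) ℝ)
    (y : ℤ → Ω → EuclideanSpace ℝ (Fin M)) (t : ℤ) (ω : Ω) : EuclideanSpace ℝ (Fin N) :=
  ∑' j : ℕ, (F ^ j * K).toEuclideanLin (y (t - ((j : ℤ) + 1)) ω)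

theorem measurable_toEuclideanLin (A : Matrix (Fin N) (Fin M) ℝ) :
    Measurable fun u : EuclideanSpace ℝ (Fin M) => A.toEuclideanLin u :=
  (LinearMap.continuous_of_finiteDimensional _).measurable

omit [MeasurableSpace Ω] in
theorem measurable_past {s t : ℤ} (hst : s < t) : Measurable[past y t] (y s) :=
  (comap_measurable (y s)).mono
    (le_iSup (fun s : Set.Iio t => MeasurableSpace.comap (y s) inferInstance) ⟨s, hst⟩) le_rfl

omit [MeasurableSpace Ω] in
theorem measurable_observer (t : ℤ) : Measurable[past y t] (observer F K y t) := by
  have h : ∀ j : ℕ, Measurable[past y t] fun ω =>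
      (F ^ j * K).toEuclideanLin (y (t - ((j : ℤ) + 1)) ω) := fun j =>
    (measurable_toEuclideanLin (F ^ j * K)).comp (measurable_past (by omega))
  let := past y t
  exact Measurable.tsum h

variable {c r : ℝ} (hc : 0 ≤ c) (hr0 : 0 ≤ r) (hr1 : r < 1) (hF : ∀ k : ℕ, ‖F ^ k‖ ≤ c * r ^ k)
  {b : ENNReal} (hb : b ≠ ⊤) (hy : ∀ t, MemLp (y t) 2 P) (hyb : ∀ t, eLpNorm (y t) 2 P ≤ b)

include hc hr0 hr1 hF hb hyb in
theorem exists_tsum_eLpNorm_observer_le : ∃ B : ENNReal, B ≠ ⊤ ∧ ∀ t : ℤ,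
    ∑' j : ℕ, eLpNorm (fun ω => (F ^ j * K).toEuclideanLin (y (t - ((j : ℤ) + 1)) ω)) 2 P ≤ B := by
  refine ⟨∑' j : ℕ, ENNReal.ofReal (c * r ^ j * ‖K‖) * b, ?_, fun t =>
    ENNReal.tsum_le_tsum fun j => ?_⟩
  · rw [ENNReal.tsum_mul_right]
    refine ENNReal.mul_ne_top ?_ hb
    rw [← ENNReal.ofReal_tsum_of_nonneg (fun j => by positivity)
      (((summable_geometric_of_lt_one hr0 hr1).mul_left c).mul_right ‖K‖)]
    exact ENNReal.ofReal_ne_top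
  · refine (eLpNorm_toEuclideanLin_le _ _).trans ?_
    gcongr
    · exact (Matrix.frobenius_norm_mul _ _).trans (by gcongr; exact hF j)
    · exact hyb _

include hc hr0 hr1 hF hb hy hyb in
theorem summable_observer (t : ℤ) : ∀ᵐ ω ∂P,
    Summable fun j : ℕ => (F ^ j * K).toEuclideanLin (y (t - ((j : ℤ) + 1)) ω) := by
  obtain ⟨B, hB, hle⟩ := exists_tsum_eLpNorm_observer_le (K := K) hc hr0 hr1 hF hb hyb
  filter_upwards [summable_norm_of_tsum_eLpNorm_ne_top (p := 2) (by norm_num)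
    (fun j : ℕ => (memLp_toEuclideanLin (F ^ j * K) (hy (t - ((j : ℤ) + 1)))).1)
    (ne_top_of_le_ne_top hB (hle t))] with ω hω
  exact hω.of_norm

include hc hr0 hr1 hF hb hy hyb in
theorem exists_eLpNorm_observer_le : ∃ B : ENNReal, B ≠ ⊤ ∧
    ∀ t : ℤ, eLpNorm (observer F K y t) 2 P ≤ B := by
  obtain ⟨B, hB, hle⟩ := exists_tsum_eLpNorm_observer_le (K := K) hc hr0 hr1 hF hb hyb
  refine ⟨B, hB, fun t => ?_⟩
  have hm := fun j : ℕ => (memLp_toEuclideanLin (F ^ j * K) (hy (t - ((j : ℤ) + 1)))).1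
  -- Fatou: the uniform bound on the partial sums passes to the almost sure limit.
  refine Lp.eLpNorm_le_of_ae_tendsto (u := atTop)
    (f := fun n : ℕ => ∑ j ∈ Finset.range n, fun ω =>
      (F ^ j * K).toEuclideanLin (y (t - ((j : ℤ) + 1)) ω))
    (Eventually.of_forall fun n => ?_) (fun n => Finset.aestronglyMeasurable_sum _ fun j _ => hm j) ?_
  · refine (eLpNorm_sum_le (fun j _ => hm j) (by norm_num)).trans ?_
    exact (ENNReal.sum_le_tsum _).trans (hle t)
  · filter_upwards [summable_observer (K := K) hc hr0 hr1 hF hb hy hyb t] with ω hω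
    simpa [Finset.sum_apply, observer] using hω.hasSum.tendsto_sum_nat

include hc hr0 hr1 hF hb hy hyb in
theorem observer_succ (t : ℤ) : ∀ᵐ ω ∂P,
    observer F K y (t + 1) ω = F.toEuclideanLin (observer F K y t ω) + K.toEuclideanLin (y t ω) := by
  filter_upwards [summable_observer (K := K) hc hr0 hr1 hF hb hy hyb t,
    summable_observer (K := K) hc hr0 hr1 hF hb hy hyb (t + 1)] with ω h1 h2
  have h3 : F.toEuclideanLin (observer F K y t ω) =
      ∑' j : ℕ, F.toEuclideanLin ((F ^ j * K).toEuclideanLin (y (t - ((j : ℤ) + 1)) ω)) :=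
    (LinearMap.toContinuousLinearMap F.toEuclideanLin).map_tsum h1
  rw [h3, observer, h2.tsum_eq_zero_add, add_comm]
  congr 1
  · refine tsum_congr fun j => ?_
    rw [← toEuclideanLin_mul_apply, ← Matrix.mul_assoc, ← pow_succ']
    push_cast
    rw [show t + 1 - ((j : ℤ) + 1 + 1) = t - (j + 1) by ring]
  · simp

end Observer

/-! ### Second moments of the observer error -/

section KalmanFilter

variable {Ω : Type*} [MeasurableSpace Ω] {P : Measure Ω} [IsProbabilityMeasure P] {N M : ℕ}
  {A C : Matrix (Fin N) (Fin N) ℝ} {G : Matrix (Fin M) (Fin N) ℝ} {R : Matrix (Fin M) (Fin M) ℝ}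
  {x w : ℤ → Ω → EuclideanSpace ℝ (Fin N)} {y v : ℤ → Ω → EuclideanSpace ℝ (Fin M)}

/-- The process `e` is a bounded error process of a stable observer with gain `K`. -/
structure IsObserverError (P : Measure Ω) (A C : Matrix (Fin N) (Fin N) ℝ)
    (G : Matrix (Fin M) (Fin N) ℝ) (w : ℤ → Ω → EuclideanSpace ℝ (Fin N))
    (v : ℤ → Ω → EuclideanSpace ℝ (Fin M)) (K : Matrix (Fin N) (Fin M) ℝ)
    (e : ℤ → Ω → EuclideanSpace ℝ (Fin N)) : Prop where
  memLp : ∀ t, MemLp (e t) 2 P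
  bounded : ∃ c : ENNReal, c ≠ ⊤ ∧ ∀ t, eLpNorm (e t) 2 P ≤ c
  stable : Tendsto (fun k : ℕ => ‖(A - K * G) ^ k‖) atTop (𝓝 0)
  error_eq : ∀ t, ∀ᵐ ω ∂P, e (t + 1) ω = (A - K * G).toEuclideanLin (e t ω) +
    (C.toEuclideanLin (w (t + 1) ω) + (-K).toEuclideanLin (v (t + 1 - 1) ω))

omit [IsProbabilityMeasure P] in
-- Subtracting the observer equation from the state equation and inserting `y = G x + v` removes `x`
-- and `y` except through the error.
theorem IsGaussianDFM.isObserverError (h : IsGaussianDFM P A C G R x w y v)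
    {K : Matrix (Fin N) (Fin M) ℝ} {c r : ℝ} (hc : 0 ≤ c) (hr0 : 0 ≤ r) (hr1 : r < 1)
    (hF : ∀ k : ℕ, ‖(A - K * G) ^ k‖ ≤ c * r ^ k) :
    IsObserverError P A C G w v K (fun t ω => x t ω - observer (A - K * G) K y t ω) := by
  obtain ⟨b, hb, hyb⟩ := h.exists_eLpNorm_y_le
  obtain ⟨B, hB, hle⟩ := exists_eLpNorm_observer_le (K := K) hc hr0 hr1 hF hb h.memLp_y hyb
  have hom : ∀ t, MemLp (observer (A - K * G) K y t) 2 P := fun t =>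
    ⟨((measurable_observer t).mono (past_le h.measurable_y t) le_rfl).aestronglyMeasurable,
      (hle t).trans_lt hB.lt_top⟩
  refine ⟨fun t => (h.memLp_x t).sub (hom t), ⟨eLpNorm (x 0) 2 P + B,
    ENNReal.add_ne_top.2 ⟨(h.memLp_x 0).2.ne, hB⟩, fun t => ?_⟩, ?_, fun t => ?_⟩
  · refine (eLpNorm_sub_le (h.memLp_x t).1 (hom t).1 (by norm_num)).trans ?_
    rw [h.eLpNorm_x 0 t]
    gcongr
    exact hle t
  · refine squeeze_zero (fun _ => norm_nonneg _) hF ?_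
    simpa using (tendsto_pow_atTop_nhds_zero_of_lt_one hr0 hr1).const_mul c
  · filter_upwards [observer_succ (K := K) hc hr0 hr1 hF hb h.memLp_y hyb t, h.state_eq t,
      h.obs_eq t] with ω h1 h2 h3
    rw [h1, h2, h3, add_sub_cancel_right]
    simp only [map_add, map_sub, map_neg, LinearMap.sub_apply, LinearMap.neg_apply,
      toEuclideanLin_mul_apply]
    abel

namespace IsObserverError

variable {K : Matrix (Fin N) (Fin M) ℝ} {e : ℤ → Ω → EuclideanSpace ℝ (Fin N)}
  (h : IsGaussianDFM P A C G R x w y v) (he : IsObserverError P A C G w v K e)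
include h he

theorem inGaussSpace (t : ℤ) : InGaussSpace P (noise w v) (e t) := by
  obtain ⟨c, hc, hle⟩ := he.bounded
  -- The shock at time `t` pairs `w_t` with `v_{t-1}`; the index `t + 1 - 1` in `error_eq` is this
  -- shock at `t + 1`.
  exact inGaussSpace_autoregression
    (u := fun t ω => C.toEuclideanLin (w t ω) + (-K).toEuclideanLin (v (t - 1) ω))
    hc hle he.memLp (fun s => ((h.inGaussSpace_w s).toEuclideanLin C).add
      ((h.inGaussSpace_v (s - 1)).toEuclideanLin (-K))) he.stable he.error_eq t

omit [IsProbabilityMeasure P] in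
/-- The cross moments of the error with any random vector obey the error recursion. -/
theorem crossMoment_left {n : ℕ} {z : Ω → EuclideanSpace ℝ (Fin n)} (hz : MemLp z 2 P) (t : ℤ) :
    crossMoment P (e t) z = (A - K * G) * crossMoment P (e (t - 1)) z +
      (C * crossMoment P (w t) z - K * crossMoment P (v (t - 1)) z) := by
  have herr := he.error_eq (t - 1)
  rw [sub_add_cancel] at herr
  have hshock : MemLp (fun ω => C.toEuclideanLin (w t ω) + (-K).toEuclideanLin (v (t - 1) ω)) 2 P :=
    (memLp_toEuclideanLin C (h.memLp_w t)).add (memLp_toEuclideanLin (-K) (h.memLp_v _))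
  rw [crossMoment_congr herr (ae_eq_refl _),
    crossMoment_add_left (memLp_toEuclideanLin _ (he.memLp _)) hshock hz,
    crossMoment_toEuclideanLin_left _ (he.memLp _) hz,
    crossMoment_lin_left C (-K) (h.memLp_w _) (h.memLp_v _) hz, Matrix.neg_mul, ← sub_eq_add_neg]

omit [IsProbabilityMeasure P] in
theorem crossMoment_right {n : ℕ} {z : Ω → EuclideanSpace ℝ (Fin n)} (hz : MemLp z 2 P) (t : ℤ) :
    crossMoment P z (e t) = crossMoment P z (e (t - 1)) * (A - K * G)ᵀ +
      (crossMoment P z (w t) * Cᵀ - crossMoment P z (v (t - 1)) * Kᵀ) := by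
  rw [← crossMoment_transpose, he.crossMoment_left h hz]
  simp only [Matrix.transpose_add, Matrix.transpose_sub, Matrix.transpose_mul,
    crossMoment_transpose]

omit [IsProbabilityMeasure P] h in
theorem exists_norm_crossMoment_le {n : ℕ} {z : ℤ → Ω → EuclideanSpace ℝ (Fin n)} {d : ENNReal}
    (hd : d ≠ ⊤) (hz : ∀ t, MemLp (z t) 2 P) (hzd : ∀ t, eLpNorm (z t) 2 P ≤ d) :
    ∃ b : ℝ, ∀ t, ‖crossMoment P (e t) (z t)‖ ≤ b := by
  obtain ⟨c, hc, hle⟩ := he.bounded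
  refine ⟨√(N * n) * (c.toReal * d.toReal), fun t =>
    (norm_crossMoment_le (he.memLp t) (hz t)).trans ?_⟩
  gcongr
  exacts [hle t, hzd t]

omit [IsProbabilityMeasure P] in
theorem crossMoment_w {s t : ℤ} (hst : s < t) : crossMoment P (e s) (w t) = 0 := by
  obtain ⟨b, hb⟩ := he.exists_norm_crossMoment_le (z := fun _ => w t) (h.memLp_w t).2.ne
    (fun _ => h.memLp_w t) (fun _ => le_rfl)
  refine eq_zero_of_bounded_recursion (D := fun s => crossMoment P (e s) (w t)) (L := 1)
    he.stable (fun k => (by rw [one_pow])) hb (t := s) fun r hr => ?_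
  rw [he.crossMoment_left h (h.memLp_w t), h.crossMoment_w_w (by omega), h.crossMoment_v_w]
  simp

omit [IsProbabilityMeasure P] in
-- Equality `s = t` is allowed, unlike for `w`, because `e_s` involves `v` only up to time `s - 1`.
theorem crossMoment_v {s t : ℤ} (hst : s ≤ t) : crossMoment P (e s) (v t) = 0 := by
  obtain ⟨b, hb⟩ := he.exists_norm_crossMoment_le (z := fun _ => v t) (h.memLp_v t).2.ne
    (fun _ => h.memLp_v t) (fun _ => le_rfl)
  refine eq_zero_of_bounded_recursion (D := fun s => crossMoment P (e s) (v t)) (L := 1)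
    he.stable (fun k => (by rw [one_pow])) hb (t := s) fun r hr => ?_
  rw [he.crossMoment_left h (h.memLp_v t), h.crossMoment_v_v (by omega), h.crossMoment_w_v]
  simp

/-- The error covariance is determined by the Lyapunov equation it satisfies. -/
theorem crossMoment_self (hR : R.PosSemidef) {S : Matrix (Fin N) (Fin N) ℝ}
    (hS : S = gainStep A C G R K S) (t : ℤ) : crossMoment P (e t) (e t) = S := by
  obtain ⟨c, hc, hle⟩ := he.bounded
  obtain ⟨b, hb⟩ := he.exists_norm_crossMoment_le hc he.memLp hle
  obtain ⟨l, hl⟩ := he.stable.bddAbove_range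
  rw [← sub_eq_zero]
  refine eq_zero_of_bounded_recursion (D := fun s => crossMoment P (e s) (e s) - S)
    (L := (A - K * G)ᵀ) (l := l) (b := b + ‖S‖) he.stable (fun k => ?_)
    (fun s => (norm_sub_le _ _).trans (by gcongr; exact hb s)) (t := t) fun s hs => ?_
  · rw [← Matrix.transpose_pow, Matrix.frobenius_norm_transpose]
    exact hl ⟨k, rfl⟩
  · have hwe : crossMoment P (w s) (e (s - 1)) = 0 := by
      rw [← crossMoment_transpose, he.crossMoment_w h (sub_one_lt s), Matrix.transpose_zero]
    have hve : crossMoment P (v (s - 1)) (e (s - 1)) = 0 := by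
      rw [← crossMoment_transpose, he.crossMoment_v h le_rfl, Matrix.transpose_zero]
    rw [he.crossMoment_left h (he.memLp s), he.crossMoment_right h (he.memLp (s - 1)),
      he.crossMoment_right h (h.memLp_w s), he.crossMoment_right h (h.memLp_v (s - 1)),
      he.crossMoment_w h (sub_one_lt s), he.crossMoment_v h le_rfl, hwe, hve, h.crossMoment_w_self,
      h.crossMoment_v_self hR, h.crossMoment_w_v, h.crossMoment_v_w]
    nth_rw 1 [hS]
    rw [gainStep]
    simp only [Matrix.mul_sub, Matrix.sub_mul, Matrix.zero_mul, zero_add, add_zero,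
      sub_zero, zero_sub, Matrix.one_mul, Matrix.mul_neg, Matrix.mul_assoc]
    abel

variable (hA : Tendsto (fun k : ℕ => ‖A ^ k‖) atTop (𝓝 0))
include hA

/-- Both `E[e xᵀ]` and `S` satisfy the recursion `D_s = C Cᵀ + (A - K G) D_{s-1} Aᵀ`; the difference
solves the homogeneous one and is bounded. -/
theorem crossMoment_x {S : Matrix (Fin N) (Fin N) ℝ}
    (hS : S = C * Cᵀ + (A - K * G) * S * Aᵀ) (t : ℤ) : crossMoment P (e t) (x t) = S := by
  obtain ⟨b, hb⟩ := he.exists_norm_crossMoment_le (h.memLp_x 0).2.ne h.memLp_x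
    (fun t => (h.eLpNorm_x t 0).le)
  obtain ⟨l, hl⟩ := hA.bddAbove_range
  rw [← sub_eq_zero]
  refine eq_zero_of_bounded_recursion (D := fun s => crossMoment P (e s) (x s) - S)
    (L := Aᵀ) (l := l) (b := b + ‖S‖) he.stable (fun k => ?_)
    (fun s => (norm_sub_le _ _).trans (by gcongr; exact hb s)) (t := t) fun s hs => ?_
  · rw [← Matrix.transpose_pow, Matrix.frobenius_norm_transpose]
    exact hl ⟨k, rfl⟩
  · have hwx : crossMoment P (w s) (x (s - 1)) = 0 := by
      rw [← crossMoment_transpose, h.crossMoment_x_w hA (sub_one_lt s), Matrix.transpose_zero]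
    have hvx : ∀ r q, crossMoment P (v r) (x q) = 0 := fun r q => by
      rw [← crossMoment_transpose, h.crossMoment_x_v hA, Matrix.transpose_zero]
    have hxr : ∀ {n : ℕ} {z : Ω → EuclideanSpace ℝ (Fin n)}, MemLp z 2 P →
        crossMoment P z (x s) = crossMoment P z (x (s - 1)) * Aᵀ + crossMoment P z (w s) * Cᵀ :=
      fun hz => by
        rw [crossMoment_congr (ae_eq_refl _) (h.state_eq' s),
          crossMoment_lin_right A C hz (h.memLp_x _) (h.memLp_w _)]
    rw [he.crossMoment_left h (h.memLp_x s), hxr (he.memLp _), hxr (h.memLp_w s), hvx, hwx,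
      he.crossMoment_w h (sub_one_lt s), h.crossMoment_w_self]
    nth_rw 1 [hS]
    simp only [Matrix.mul_sub, Matrix.sub_mul, Matrix.zero_mul, Matrix.mul_zero, zero_add, add_zero,
      sub_zero, Matrix.one_mul, Matrix.mul_assoc]
    abel

/-- The error of the observer with the Kalman gain is uncorrelated with the past. -/
theorem crossMoment_past (hR : R.PosSemidef) {S : Matrix (Fin N) (Fin N) ℝ}
    (hS : S = C * Cᵀ + (A - K * G) * S * Aᵀ) (hK : (A - K * G) * S * Gᵀ = K * R) {s t : ℤ}
    (hst : s < t) : crossMoment P (e t) (y s) = 0 := by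
  have hyr : ∀ {n : ℕ} {z : Ω → EuclideanSpace ℝ (Fin n)} (q : ℤ), MemLp z 2 P →
      crossMoment P z (y q) = crossMoment P z (x q) * Gᵀ + crossMoment P z (v q) :=
    fun q hz => by
      rw [crossMoment_congr (ae_eq_refl _) (h.obs_eq q),
        crossMoment_add_right hz (memLp_toEuclideanLin G (h.memLp_x q)) (h.memLp_v q),
        crossMoment_toEuclideanLin_right G hz (h.memLp_x q)]
  have hvx : ∀ r q, crossMoment P (v r) (x q) = 0 := fun r q => by
    rw [← crossMoment_transpose, h.crossMoment_x_v hA, Matrix.transpose_zero]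
  have hwy : ∀ {r q : ℤ}, q < r → crossMoment P (w r) (y q) = 0 := fun {r q} hqr => by
    rw [hyr q (h.memLp_w r), ← crossMoment_transpose, h.crossMoment_x_w hA hqr,
      h.crossMoment_w_v]
    simp
  obtain ⟨n, rfl⟩ : ∃ n : ℕ, t = s + 1 + n := ⟨(t - s - 1).toNat, by omega⟩
  clear hst
  -- At lag one the moment is `(A - K G) S Gᵀ - K R = 0`; each further lag multiplies by `A - K G`,
  -- as the newer noises are uncorrelated with `y_s`.
  induction n with
  | zero =>
    simp only [Nat.cast_zero, add_zero]
    rw [he.crossMoment_left h (h.memLp_y s), add_sub_cancel_right, hyr s (he.memLp s),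
      he.crossMoment_x h hA hS, he.crossMoment_v h le_rfl, hwy (lt_add_one s),
      hyr s (h.memLp_v s), hvx, h.crossMoment_v_self hR, add_zero, ← Matrix.mul_assoc, hK]
    simp
  | succ n ih =>
    rw [he.crossMoment_left h (h.memLp_y s), hwy (by push_cast; omega)]
    have : s + 1 + ((n + 1 : ℕ) : ℤ) - 1 = s + 1 + n := by push_cast; ring
    rw [this, ih, hyr s (h.memLp_v _), hvx, h.crossMoment_v_v (by omega)]
    simp

end IsObserverError

end KalmanFilter


/-! ### The Kalman filter as conditional expectation and the VAR -/

section Prediction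

variable {Ω : Type*} [MeasurableSpace Ω] {P : Measure Ω} [IsProbabilityMeasure P] {N M : ℕ}
  {A C : Matrix (Fin N) (Fin N) ℝ} {G : Matrix (Fin M) (Fin N) ℝ} {R : Matrix (Fin M) (Fin M) ℝ}
  {x w : ℤ → Ω → EuclideanSpace ℝ (Fin N)} {y v : ℤ → Ω → EuclideanSpace ℝ (Fin M)}

/-- If `z` is the sum of a function of the past and an uncorrelated member of the Gaussian space,
the first summand is the conditional expectation of `z` given the past. -/
theorem condExp_past_eq {ι : Type*} {W : ι → Ω → ℝ} (hW : IsGaussianProcess W P)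
    (hW0 : ∀ i, ∫ ω, W i ω ∂P = 0) {n : ℕ} {z p e : Ω → EuclideanSpace ℝ (Fin n)} {t : ℤ}
    (hym : ∀ s, Measurable (y s)) (hy : ∀ s, InGaussSpace P W (y s))
    (hz : z =ᵐ[P] fun ω => p ω + e ω) (hpm : Measurable[past y t] p) (hp : MemLp p 2 P)
    (he : InGaussSpace P W e) (he2 : MemLp e 2 P)
    (h : ∀ s < t, crossMoment P e (y s) = 0) : P[z | past y t] =ᵐ[P] p := by
  have h1 := condExp_past_eq_zero hW hW0 hym hy he h
  have h2 : P[p | past y t] = p :=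
    condExp_of_stronglyMeasurable (past_le hym t) hpm.stronglyMeasurable
      (hp.integrable (by norm_num))
  have h3 := condExp_add (m := past y t) (hp.integrable (μ := P) (by norm_num))
    (he2.integrable (by norm_num))
  refine (condExp_congr_ae hz).trans (h3.trans ?_)
  filter_upwards [h1] with ω hω
  rw [Pi.add_apply, h2, hω, Pi.zero_apply, add_zero]

variable {S : Matrix (Fin N) (Fin N) ℝ} (h : IsGaussianDFM P A C G R x w y v)
  (hA : Tendsto (fun k : ℕ => ‖A ^ k‖) atTop (𝓝 0)) (hR : R.PosDef) (hC : IsUnit C)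
  (hS : S.PosSemidef) (hRic : Riccati A C G R S)

/-- The stationary Kalman filter. -/
noncomputable def kalmanFilter (A : Matrix (Fin N) (Fin N) ℝ) (G : Matrix (Fin M) (Fin N) ℝ)
    (R : Matrix (Fin M) (Fin M) ℝ) (S : Matrix (Fin N) (Fin N) ℝ)
    (y : ℤ → Ω → EuclideanSpace ℝ (Fin M)) (t : ℤ) : Ω → EuclideanSpace ℝ (Fin N) :=
  observer (A - kalmanGain A G R S * G) (kalmanGain A G R S) y t

namespace IsGaussianDFM

include h hR hC hS hRic

omit [IsProbabilityMeasure P] in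
theorem isObserverError_kalmanFilter :
    IsObserverError P A C G w v (kalmanGain A G R S)
      (fun t ω => x t ω - kalmanFilter A G R S y t ω) := by
  obtain ⟨c, r, hc, hr0, hr1, hF⟩ := hRic.exists_norm_pow_le hR hC hS
  exact h.isObserverError hc hr0 hr1 hF

omit [IsProbabilityMeasure P] in
theorem kalmanFilter_succ (t : ℤ) : ∀ᵐ ω ∂P, kalmanFilter A G R S y (t + 1) ω =
    (A - kalmanGain A G R S * G).toEuclideanLin (kalmanFilter A G R S y t ω) +
      (kalmanGain A G R S).toEuclideanLin (y t ω) := by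
  obtain ⟨c, r, hc, hr0, hr1, hF⟩ := hRic.exists_norm_pow_le hR hC hS
  obtain ⟨b, hb, hyb⟩ := h.exists_eLpNorm_y_le
  exact observer_succ hc hr0 hr1 hF hb h.memLp_y hyb t

omit [IsProbabilityMeasure P] in
theorem hasSum_kalmanFilter (t : ℤ) : ∀ᵐ ω ∂P, HasSum
    (fun j : ℕ => (varCoeff A G R S (j + 1)).toEuclideanLin (y (t - ((j : ℤ) + 1)) ω))
    (G.toEuclideanLin (kalmanFilter A G R S y t ω)) := by
  obtain ⟨c, r, hc, hr0, hr1, hF⟩ := hRic.exists_norm_pow_le hR hC hS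
  obtain ⟨b, hb, hyb⟩ := h.exists_eLpNorm_y_le
  filter_upwards [summable_observer (K := kalmanGain A G R S) hc hr0 hr1 hF hb h.memLp_y hyb t]
    with ω hω
  have := hω.hasSum.mapL (LinearMap.toContinuousLinearMap G.toEuclideanLin)
  simp only [LinearMap.coe_toContinuousLinearMap', ← toEuclideanLin_mul_apply,
    ← Matrix.mul_assoc] at this
  exact this

omit [IsProbabilityMeasure P] in
theorem memLp_kalmanFilter (t : ℤ) : MemLp (kalmanFilter A G R S y t) 2 P := by
  have := (h.memLp_x t).sub ((h.isObserverError_kalmanFilter hR hC hS hRic).memLp t)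
  refine (memLp_congr_ae (Eventually.of_forall fun ω => ?_)).1 this
  simp

include hA

theorem crossMoment_stateError_past {s t : ℤ} (hst : s < t) :
    crossMoment P (fun ω => x t ω - kalmanFilter A G R S y t ω) (y s) = 0 :=
  (h.isObserverError_kalmanFilter hR hC hS hRic).crossMoment_past h hA hR.posSemidef
    (hRic.eq_closedLoop hR hS) (closedLoop_mul_eq_gain_mul hR hS) hst

theorem condExp_x (t : ℤ) : P[x t | past y t] =ᵐ[P] kalmanFilter A G R S y t := by
  have he := h.isObserverError_kalmanFilter hR hC hS hRic
  exact condExp_past_eq h.isGaussianProcess_noise h.integral_noise h.measurable_y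
    (h.inGaussSpace_y hA) (Eventually.of_forall fun ω => (add_sub_cancel _ _).symm)
    (measurable_observer t) (h.memLp_kalmanFilter hR hC hS hRic t) (he.inGaussSpace h t) (he.memLp t)
    fun s hs => h.crossMoment_stateError_past hA hR hC hS hRic hs

theorem predError_x (t : ℤ) :
    predError P x y t =ᵐ[P] fun ω => x t ω - kalmanFilter A G R S y t ω := by
  filter_upwards [h.condExp_x hA hR hC hS hRic t] with ω hω
  rw [predError, Pi.sub_apply, hω]

theorem memLp_predError_x (t : ℤ) : MemLp (predError P x y t) 2 P :=
  (memLp_congr_ae (h.predError_x hA hR hC hS hRic t)).2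
    ((h.isObserverError_kalmanFilter hR hC hS hRic).memLp t)

theorem crossMoment_predError_x (t : ℤ) :
    crossMoment P (predError P x y t) (predError P x y t) = S := by
  have heq := h.predError_x hA hR hC hS hRic t
  rw [crossMoment_congr heq heq]
  exact (h.isObserverError_kalmanFilter hR hC hS hRic).crossMoment_self h hR.posSemidef hRic t

/-- Conditional expectation contracts `L²`. Unlike the bound from the series, this one is uniform in
`M`. -/
theorem eLpNorm_kalmanFilter_le (t : ℤ) :
    eLpNorm (kalmanFilter A G R S y t) 2 P ≤ eLpNorm (x t) 2 P := by
  rw [← eLpNorm_congr_ae (h.condExp_x hA hR hC hS hRic t)]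
  exact eLpNorm_condExp_le_eLpNorm _ (by norm_num)

theorem crossMoment_innovation_past {s t : ℤ} (hst : s < t) :
    crossMoment P (fun ω => G.toEuclideanLin (x t ω - kalmanFilter A G R S y t ω) + v t ω) (y s)
      = 0 := by
  have he := h.isObserverError_kalmanFilter hR hC hS hRic
  have hvx : crossMoment P (v t) (x s) = 0 := by
    rw [← crossMoment_transpose, h.crossMoment_x_v hA, Matrix.transpose_zero]
  have hvy : crossMoment P (v t) (y s) = 0 := by
    rw [crossMoment_congr (ae_eq_refl _) (h.obs_eq s),
      crossMoment_add_right (h.memLp_v t) (memLp_toEuclideanLin G (h.memLp_x s)) (h.memLp_v s),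
      crossMoment_toEuclideanLin_right G (h.memLp_v t) (h.memLp_x s), hvx,
      h.crossMoment_v_v hst.ne']
    simp
  rw [crossMoment_add_left (memLp_toEuclideanLin G (he.memLp t)) (h.memLp_v t) (h.memLp_y s),
    crossMoment_toEuclideanLin_left G (he.memLp t) (h.memLp_y s),
    h.crossMoment_stateError_past hA hR hC hS hRic hst, hvy]
  simp

theorem condExp_y (t : ℤ) :
    P[y t | past y t] =ᵐ[P] fun ω => G.toEuclideanLin (kalmanFilter A G R S y t ω) := by
  have he := h.isObserverError_kalmanFilter hR hC hS hRic
  refine condExp_past_eq h.isGaussianProcess_noise h.integral_noise h.measurable_y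
    (h.inGaussSpace_y hA)
    (e := fun ω => G.toEuclideanLin (x t ω - kalmanFilter A G R S y t ω) + v t ω) ?_
    ((measurable_toEuclideanLin G).comp (measurable_observer t))
    (memLp_toEuclideanLin G (h.memLp_kalmanFilter hR hC hS hRic t))
    (((he.inGaussSpace h t).toEuclideanLin G).add (h.inGaussSpace_v t))
    ((memLp_toEuclideanLin G (he.memLp t)).add (h.memLp_v t))
    fun s hs => h.crossMoment_innovation_past hA hR hC hS hRic hs
  filter_upwards [h.obs_eq t] with ω hω
  rw [hω, map_sub]
  abel

theorem predError_y (t : ℤ) : predError P y y t =ᵐ[P]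
    fun ω => G.toEuclideanLin (x t ω - kalmanFilter A G R S y t ω) + v t ω := by
  filter_upwards [h.condExp_y hA hR hC hS hRic t, h.obs_eq t] with ω h1 h2
  rw [predError, Pi.sub_apply, h1, h2, map_sub]
  abel

theorem memLp_predError_y (t : ℤ) : MemLp (predError P y y t) 2 P :=
  (memLp_congr_ae (h.predError_y hA hR hC hS hRic t)).2
    ((memLp_toEuclideanLin G ((h.isObserverError_kalmanFilter hR hC hS hRic).memLp t)).add
      (h.memLp_v t))

theorem hasSum_var (t : ℤ) : ∀ᵐ ω ∂P, HasSum
    (fun j : ℕ => (varCoeff A G R S (j + 1)).toEuclideanLin (y (t - ((j : ℤ) + 1)) ω))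
    (y t ω - predError P y y t ω) := by
  filter_upwards [h.hasSum_kalmanFilter hR hC hS hRic t, h.condExp_y hA hR hC hS hRic t]
    with ω h1 h2
  rwa [predError, Pi.sub_apply, sub_sub_cancel, h2]

theorem crossMoment_predError_y_past {s t : ℤ} (hst : s < t) :
    crossMoment P (predError P y y t) (y s) = 0 := by
  rw [crossMoment_congr (h.predError_y hA hR hC hS hRic t) (ae_eq_refl _)]
  exact h.crossMoment_innovation_past hA hR hC hS hRic hst

theorem crossMoment_predError_y (t : ℤ) :
    crossMoment P (predError P y y t) (predError P y y t) = innovCov G R S := by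
  have heq := h.predError_y hA hR hC hS hRic t
  have he := h.isObserverError_kalmanFilter hR hC hS hRic
  have hGe := memLp_toEuclideanLin G (he.memLp t)
  have hev := he.crossMoment_v h (le_refl t)
  have hve : crossMoment P (v t) (fun ω => x t ω - kalmanFilter A G R S y t ω) = 0 := by
    rw [← crossMoment_transpose, hev, Matrix.transpose_zero]
  rw [crossMoment_congr heq heq,
    crossMoment_add_left hGe (h.memLp_v t)
      (show MemLp (fun ω => G.toEuclideanLin (x t ω - kalmanFilter A G R S y t ω) + v t ω) 2 P from
        hGe.add (h.memLp_v t)),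
    crossMoment_add_right hGe hGe (h.memLp_v t), crossMoment_add_right (h.memLp_v t) hGe (h.memLp_v t),
    crossMoment_toEuclideanLin_left G (he.memLp t) hGe,
    crossMoment_toEuclideanLin_left G (he.memLp t) (h.memLp_v t),
    crossMoment_toEuclideanLin_right G (he.memLp t) (he.memLp t),
    crossMoment_toEuclideanLin_right G (h.memLp_v t) (he.memLp t), hev, hve,
    h.crossMoment_v_self hR.posSemidef, he.crossMoment_self h hR.posSemidef hRic t, innovCov]
  simp [Matrix.mul_assoc]

/-- The error of the first-order VAR is controlled by the closed-loop matrix. -/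
theorem eLpNorm_firstOrder_le (t : ℤ) :
    eLpNorm (fun ω => y t ω - ((G * kalmanGain A G R S).toEuclideanLin (y (t - 1) ω)
      + predError P y y t ω)) 2 P ≤
      ENNReal.ofReal (‖G‖ * ‖A - kalmanGain A G R S * G‖) * eLpNorm (x (t - 1)) 2 P := by
  set F := A - kalmanGain A G R S * G with hFdef
  have hstep := h.kalmanFilter_succ hR hC hS hRic (t - 1)
  rw [sub_add_cancel] at hstep
  -- One filter step gives `y_t - a_t = G z_t = G F z_{t-1} + G K y_{t-1}` with `z` the filter, so
  -- only `G F z_{t-1}` remains.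
  calc _ = eLpNorm (fun ω => (G * F).toEuclideanLin (kalmanFilter A G R S y (t - 1) ω)) 2 P := by
        refine eLpNorm_congr_ae ?_
        filter_upwards [h.condExp_y hA hR hC hS hRic t, hstep] with ω h1 h2
        rw [predError, Pi.sub_apply, h1, h2, toEuclideanLin_mul_apply, toEuclideanLin_mul_apply,
          map_add]
        abel
    _ ≤ ENNReal.ofReal ‖G * F‖ * eLpNorm (kalmanFilter A G R S y (t - 1)) 2 P :=
        eLpNorm_toEuclideanLin_le _ _
    _ ≤ _ := by
        gcongr
        · exact Matrix.frobenius_norm_mul _ _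
        · exact h.eLpNorm_kalmanFilter_le hA hR hC hS hRic (t - 1)

end IsGaussianDFM

end Prediction

end DFM

/-! ### Assembly of the theorem -/

theorem mainTheorem1 {N : ℕ}
    -- the parameters: `A`, `C`, `σ` do not depend on the number `M` of observables
    (A C : Matrix (Fin N) (Fin N) ℝ) (G : (M : ℕ) → Matrix (Fin M) (Fin N) ℝ) (σ : ℝ)
    (hA_stable : DFM.IsStable A) (hA : A.rank = N) (hC : IsUnit C) (hσ : 0 < σ)
    (hG : ∀ᶠ M in atTop, (G M).rank = N)
    -- `GᵀG` is of order `M`: all its eigenvalues are bounded above and below by multiples of `M`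
    (hG_upper : (fun M : ℕ => ‖(G M)ᵀ * G M‖) =O[atTop] fun M : ℕ => (M : ℝ))
    (hG_lower : (fun M : ℕ => ‖((G M)ᵀ * G M)⁻¹‖) =O[atTop] fun M : ℕ => (M : ℝ)⁻¹)
    -- for each `M`, a dynamic factor model with measurement error covariance `σ² I`
    {Ω : ℕ → Type*} [∀ M, MeasurableSpace (Ω M)] (P : (M : ℕ) → Measure (Ω M))
    [∀ M, IsProbabilityMeasure (P M)]
    (x w : (M : ℕ) → ℤ → Ω M → EuclideanSpace ℝ (Fin N))
    (y v : (M : ℕ) → ℤ → Ω M → EuclideanSpace ℝ (Fin M))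
    (hDFM : ∀ M, DFM.IsGaussianDFM (P M) A C (G M) (σ ^ 2 • 1) (x M) (w M) (y M) (v M)) :
    ∃ S : ℕ → Matrix (Fin N) (Fin N) ℝ,
      -- `S M` is the unique positive semidefinite solution of the Riccati equation, it is
      -- invertible, and it is the covariance of the prediction error of the state
      (∀ M, (S M).PosDef ∧ DFM.Riccati A C (G M) (σ ^ 2 • 1) (S M) ∧
        (∀ S' : Matrix (Fin N) (Fin N) ℝ, S'.PosSemidef →
          DFM.Riccati A C (G M) (σ ^ 2 • 1) S' → S' = S M) ∧
        ∀ t, MemLp (DFM.predError (P M) (x M) (y M) t) 2 (P M) ∧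
          DFM.crossMoment (P M) (DFM.predError (P M) (x M) (y M) t)
            (DFM.predError (P M) (x M) (y M) t) = S M) ∧
      -- the infinite-order VAR representation, with innovations `a_t = y_t - E[y_t ∣ y^{t-1}]`
      (∀ M t, MemLp (y M t) 2 (P M) ∧ MemLp (DFM.predError (P M) (y M) (y M) t) 2 (P M) ∧
        (∀ᵐ ω ∂(P M), HasSum
          (fun j : ℕ => (DFM.varCoeff A (G M) (σ ^ 2 • 1) (S M) (j + 1)).toEuclideanLin
            (y M (t - ((j : ℤ) + 1)) ω))
          (y M t ω - DFM.predError (P M) (y M) (y M) t ω)) ∧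
        (∀ j : ℕ, 1 ≤ j →
          DFM.crossMoment (P M) (DFM.predError (P M) (y M) (y M) t) (y M (t - (j : ℤ))) = 0) ∧
        DFM.crossMoment (P M) (DFM.predError (P M) (y M) (y M) t)
          (DFM.predError (P M) (y M) (y M) t) = DFM.innovCov (G M) (σ ^ 2 • 1) (S M)) ∧
      -- the coefficients of order at least two vanish, with a rate
      (∀ j : ℕ, 2 ≤ j →
        Tendsto (fun M => ‖DFM.varCoeff A (G M) (σ ^ 2 • 1) (S M) j‖) atTop (𝓝 0) ∧
        limsup (fun M : ℕ =>
          (((M : ℝ) ^ (j - 1) * ‖DFM.varCoeff A (G M) (σ ^ 2 • 1) (S M) j‖ : ℝ) : EReal))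
          atTop < ⊤) ∧
      -- the VAR collapses to the first-order VAR `y_t = G K y_{t-1} + a_t`, in mean square
      (∀ t : ℤ, Tendsto (fun M => eLpNorm (fun ω => y M t ω -
          ((G M * DFM.kalmanGain A (G M) (σ ^ 2 • 1) (S M)).toEuclideanLin (y M (t - 1) ω)
            + DFM.predError (P M) (y M) (y M) t ω)) 2 (P M)) atTop (𝓝 0)) ∧
      -- and the first coefficient is `G K`, of rank `N`
      (∀ M, DFM.varCoeff A (G M) (σ ^ 2 • 1) (S M) 1 =
        G M * DFM.kalmanGain A (G M) (σ ^ 2 • 1) (S M)) ∧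
      (∀ M, (G M).rank = N →
        (G M * DFM.kalmanGain A (G M) (σ ^ 2 • 1) (S M)).rank = N) := by
  have ha : 0 < σ ^ 2 := by positivity
  have hR : ∀ M : ℕ, ((σ ^ 2) • (1 : Matrix (Fin M) (Fin M) ℝ)).PosDef := fun M =>
    DFM.posDef_smul_one ha
  have hpow := hA_stable.tendsto_norm_pow
  -- The Lyapunov bound for the Riccati iterates is the covariance of the state itself.
  have hex : ∀ M, ∃ S : Matrix (Fin N) (Fin N) ℝ, S.PosSemidef ∧
      DFM.Riccati A C (G M) (σ ^ 2 • 1) S := fun M =>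
    DFM.exists_riccati_solution (hR M) (DFM.crossMoment_self_posSemidef ((hDFM M).memLp_x 0))
      ((hDFM M).crossMoment_x_self hpow 0)
  choose S hS hRic using hex
  have hSd : ∀ M, (S M).PosDef := fun M => (hRic M).posDef (hR M) hC (hS M)
  refine ⟨S, fun M => ⟨hSd M, hRic M, fun S' hS' hRic' => ?_, fun t => ⟨?_, ?_⟩⟩,
    fun M t => ⟨(hDFM M).memLp_y t, ?_, ?_, fun j hj => ?_, ?_⟩, fun j hj => ⟨?_, ?_⟩, fun t => ?_,
    fun M => ?_, fun M hM => DFM.rank_mul_kalmanGain ha (hSd M) hA hM⟩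
  -- Both solutions equal the covariance of the same prediction error.
  · rw [← (hDFM M).crossMoment_predError_x hpow (hR M) hC (hS M) (hRic M) 0,
      (hDFM M).crossMoment_predError_x hpow (hR M) hC hS' hRic' 0]
  · exact (hDFM M).memLp_predError_x hpow (hR M) hC (hS M) (hRic M) t
  · exact (hDFM M).crossMoment_predError_x hpow (hR M) hC (hS M) (hRic M) t
  · exact (hDFM M).memLp_predError_y hpow (hR M) hC (hS M) (hRic M) t
  · exact (hDFM M).hasSum_var hpow (hR M) hC (hS M) (hRic M) t
  · exact (hDFM M).crossMoment_predError_y_past hpow (hR M) hC (hS M) (hRic M) (by omega)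
  · exact (hDFM M).crossMoment_predError_y hpow (hR M) hC (hS M) (hRic M) t
  · exact DFM.tendsto_varCoeff ha hS hC hRic hG hG_upper hG_lower hj
  · exact DFM.limsup_varCoeff_lt_top ha hS hC hRic hG hG_upper hG_lower hj
  -- Neither `k` nor `B` involves `M`, although the probability space changes with `M`.
  · obtain ⟨k, hk⟩ := (hpow.eventually_le_const (show (0 : ℝ) < 1 / 2 by norm_num)).exists
    set B : ENNReal := 2 * ∑ i ∈ Finset.range k, ENNReal.ofReal ‖A ^ i‖ *
      (ENNReal.ofReal ‖C‖ * eLpNorm id 2 (multivariateGaussian 0 (1 : Matrix (Fin N) (Fin N) ℝ)))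
      with hBdef
    have hB : B ≠ ⊤ := by
      refine ENNReal.mul_ne_top (by norm_num) (ENNReal.sum_ne_top.2 fun i _ =>
        ENNReal.mul_ne_top ENNReal.ofReal_ne_top (ENNReal.mul_ne_top ENNReal.ofReal_ne_top ?_))
      exact IsGaussian.memLp_two_id.2.ne
    have hlim := ENNReal.Tendsto.mul_const (b := B) (ENNReal.tendsto_ofReal
      (DFM.tendsto_norm_mul_norm_closedLoop ha hS hC hRic hG hG_upper hG_lower)) (Or.inr hB)
    rw [ENNReal.ofReal_zero, zero_mul] at hlim
    refine tendsto_of_tendsto_of_tendsto_of_le_of_le tendsto_const_nhds hlim (fun _ => zero_le)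
      fun M => ?_
    refine ((hDFM M).eLpNorm_firstOrder_le hpow (hR M) hC (hS M) (hRic M) t).trans ?_
    gcongr
    exact (hDFM M).eLpNorm_x_le hk (t - 1)
  · simp [DFM.varCoeff]
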